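/- Let $\mathbb A$ be an infinite set of names and $\mathsf{01Sub}$ the category of 01-substitution sets over $\mathbb A$: nominal sets $X$ with an equivariant operation $(x,a,i)\mapsto x(a:=i)$ ($a\in\mathbb A$, $i\in 2=\{0,1\}$) such that $a\,\#\,x(a:=i)$; $x(a:=i)=x$ if $a\,\#\,x$; and $x(a:=i)(a':=i')=x(a':=i')(a:=i)$ if $a\ne a'$. Morphisms are the equivariant maps preserving substitution. For $d\in 2$ and a map $f:X\to Y$, a $d$-open $(A,a)$-box over $f$ ($A\subseteq\mathbb A$ finite, $a\in A$) is a pair $(u,y)$ with $y\in Y$ and $u:(A\times2)\setminus\{(a,d)\}\to X$ such that $b\,\#\,u(b,i)$, $u(b,i)(b':=i')=u(b',i')(b:=i)$ for $b\neq b'$, and $f(u(b,i))=y(b:=i)$. A filler is an $x\in X$ with $f(x)=y$ and $x(b:=i)=u(b,i)$ for all $(b,i)$ in the domain of $u$. A (uniform) Kan filling operator for $d$-open boxes assigns to every $d$-open box over $f$ a filler, commuting with finite permutations and with the substitutions $(u,y)\mapsto(u,y)(c:=i)$ for $c\notin A$. For $f:X\to Y$ define $C_n$ with $\rho_n:C_n\to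 Y$ by $C_0=\emptyset$ and $$C_{n+1}=X\amalg K_n^{\uparrow}\amalg K_n^{+}\amalg K_n^{\downarrow}\amalg K_n^{-}$$ (a coproduct of nominal sets), where $K_n^\uparrow$ and $K_n^\downarrow$ are the sets of $1$-open and of $0$-open boxes over $\rho_n$, and $K_n^{+}\subseteq[\mathbb A]K_n^\uparrow$, $K_n^-\subseteq[\mathbb A]K_n^\downarrow$ are the sets of name abstractions $\langle a\rangle(u,y)$ with $(u,y)$ an $(A,a)$-box for some $A$. The map $\rho_{n+1}$ is $f$ on $X$, sends $(u,y)$ to $y$, and sends $\langle a\rangle(u,y)$ to $y(a:=d)$. Substitution on $C_{n+1}$ is that of $X$ on $X$; for a $d$-open $(A,a)$-box $(u,y)$ it is $$(u,y)(c:=i)=\begin{cases}u(c,i)&(c,i)\in(A\times2)\setminus\{(a,d)\},\\ \langle a\rangle(u,y)&(c,i)=(a,d),\\ (u(c:=i),y(c:=i))&c\notin A,\end{cases}$$ and, for $c\ne a$, $(\langle a\rangle(u,y))(c:=i)$ is $u(c,i)(a:=d)$ if $c\in A$ and $\langle a\rangle(u(c:=i),y(c:=i))$ otherwise; here elements of $C_n$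 are regarded as elements of $C_{n+1}$ along the evident inclusion $C_n\to C_{n+1}$. Let $Kf$ be the union (colimit) of the $C_n$, $\lambda_f:X\to Kf$ the inclusion, and $\rho_f:Kf\to Y$ the map induced by the $\rho_n$. Every open box $(u,y)$ over $\rho_f$ is itself an element of $Kf$, and it is a filler of itself. With the componentwise action on commutative squares $(h,k)$ ($K(h,k)$ is $h$ on $X$, $K(h,k)(u,y)=(K(h,k)\circ u,k(y))$ on open boxes, and $K(h,k)(\langle a\rangle(u,y))=\langle a\rangle(K(h,k)\circ u,k(y))$), $(K,\lambda,\rho)$ is a functorial factorisation on $\mathsf{01Sub}$; write $L:f\mapsto\lambda_f$, with counit $(1,\rho_f)$, and $R:f\mapsto\rho_f$, with unit $(\lambda_f,1)$, for the associated copointed and pointed endofunctors of $\mathsf{01Sub}^{\mathbf 2}$. **Theorem.** 1. For every $f$, $Kf$ is the colimit in $\mathsf{01Sub}$ of the countable sequence $C_0\to C_1\to C_2\to\cdots$. 2. $(K,\lambda,\rho)$ is an algebraic weak factorisation system: there are natural transformations $\Sigma:L\to L^2$ and $\Pi:R^2\to R$ that make $L$ a comonad $\mathsf L$ and $R$ a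 monad $\mathsf R$. They can be chosen such that the components $\sigma_f:Kf\to K\lambda_f$ of $\Sigma$ and $\pi_f:K\rho_f\to Kf$ of $\Pi$ satisfy $\sigma_f(u,y)=(\sigma_f\circ u,(u,y))$ and $\pi_f(u,y)=(\pi_f\circ u,y)$ on open boxes. 3. For this monad and every map $f:X\to Y$ in $\mathsf{01Sub}$, the (monad) $\mathsf R$-algebra structures on $f$ are in bijection with the pairs $(f{\uparrow},f{\downarrow})$ of Kan filling operators for $f$ for $1$-open and $0$-open boxes. Under the bijection, an algebra structure with underlying map $g:Kf\to X$ corresponds to the operators $(u,y)\mapsto g(\lambda_f\circ u,y)$, and $g$ satisfies $g(u,y)=f{\uparrow}(g\circ u,y)$ on $1$-open boxes over $\rho_f$ and $g(u,y)=f{\downarrow}(g\circ u,y)$ on $0$-open boxes over $\rho_f$. -/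

import Mathlib

open CategoryTheory

universe u

namespace KanAWFS

/-! ### Nominal sets -/

/-- The group of finite permutations of the set of names `𝔸`. -/
def FinPerm (𝔸 : Type u) : Subgroup (Equiv.Perm 𝔸) where
  carrier := {π | {a | π a ≠ a}.Finite}
  mul_mem' {π σ} hπ hσ := by
    refine (hπ.union hσ).subset fun a ha => ?_
    by_contra h
    simp only [Set.mem_union, Set.mem_ofPred_eq, not_or, not_not] at h
    exact ha (by simp [h.1, h.2])
  one_mem' := by simp
  inv_mem' {π} hπ := by
    refine Set.Finite.subset hπ fun a ha h => ha ?_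
    exact (Equiv.Perm.inv_eq_iff_eq).2 h.symm

variable {𝔸 : Type u}

open scoped Classical in
/-- The transposition `(a b)`. -/
noncomputable def swp (a b : 𝔸) : FinPerm 𝔸 :=
  ⟨Equiv.swap a b, by
    refine Set.Finite.subset (Set.toFinite {a, b}) fun c hc => ?_
    by_contra h
    simp only [Set.mem_insert_iff, Set.mem_singleton_iff, not_or] at h
    exact hc (Equiv.swap_apply_of_ne_of_ne h.1 h.2)⟩

/-- A nominal set over the names `𝔸`: a set with an action of the finite permutations in which
every element has a finite support. -/
class NominalSet (𝔸 : Type u) (X : Type u) extends MulAction (FinPerm 𝔸) X where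
  exists_support : ∀ x : X, ∃ A : Finset 𝔸, MulAction.Supports (FinPerm 𝔸) (A : Set 𝔸) x

/-- The name `a` is fresh for `x`: some finite support of `x` does not contain `a`. -/
def Fresh {X : Type u} [NominalSet 𝔸 X] (a : 𝔸) (x : X) : Prop :=
  ∃ A : Finset 𝔸, MulAction.Supports (FinPerm 𝔸) (A : Set 𝔸) x ∧ a ∉ A

section nominal

variable {X W : Type u} [NominalSet 𝔸 X] [NominalSet 𝔸 W]

theorem smul_name (π : FinPerm 𝔸) (a : 𝔸) : π • a = (π : Equiv.Perm 𝔸) a := rfl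

theorem swp_left (a b : 𝔸) : swp a b • a = b := by
  classical
  simp [smul_name, swp]

theorem swp_right (a b : 𝔸) : swp a b • b = a := by
  classical
  simp [smul_name, swp]

theorem swp_of_ne {a b c : 𝔸} (h : c ≠ a) (h' : c ≠ b) : swp a b • c = c := by
  classical
  simp [smul_name, swp, Equiv.swap_apply_of_ne_of_ne h h']

theorem swp_fix {a b : 𝔸} {C : Finset 𝔸} (ha : a ∉ C) (hb : b ∉ C) :
    ∀ ⦃c⦄, c ∈ (C : Set 𝔸) → swp a b • c = c := fun _ hc =>
  swp_of_ne (fun h => ha (h ▸ hc)) (fun h => hb (h ▸ hc))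

theorem perm_ext {π σ : FinPerm 𝔸} (h : ∀ a : 𝔸, π • a = σ • a) : π = σ :=
  Subtype.ext (Equiv.ext h)

/-- `(c'' c)(c a) = (c'' a)(c c'')` for distinct `a`, `c`, `c''`. -/
theorem swp_mul {a c c' : 𝔸} (h1 : c ≠ a) (h2 : c' ≠ a) (h3 : c ≠ c') :
    swp c' c * swp c a = swp c' a * swp c c' := by
  apply perm_ext
  intro b
  rw [mul_smul, mul_smul]
  by_cases e1 : b = a
  · subst e1
    rw [swp_right, swp_right, swp_of_ne h1.symm h2.symm, swp_right]
  by_cases e2 : b = c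
  · subst e2
    rw [swp_left, swp_left, swp_of_ne h2.symm h1.symm, swp_left]
  by_cases e3 : b = c'
  · subst e3
    rw [swp_of_ne e2 e1, swp_left, swp_right, swp_of_ne h3 h1]
  · rw [swp_of_ne e2 e1, swp_of_ne e3 e2, swp_of_ne e2 e3, swp_of_ne e3 e1]

/-- The image of a finite set of names under a permutation. -/
def permFinset (π : FinPerm 𝔸) (A : Finset 𝔸) : Finset 𝔸 :=
  A.map (π : Equiv.Perm 𝔸).toEmbedding

theorem mem_permFinset {π : FinPerm 𝔸} {A : Finset 𝔸} {b : 𝔸} :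
    b ∈ permFinset π A ↔ π⁻¹ • b ∈ A := by
  constructor
  · intro h
    obtain ⟨c, hc, rfl⟩ := Finset.mem_map.1 h
    change π⁻¹ • π • c ∈ A
    rwa [inv_smul_smul]
  · intro h
    exact Finset.mem_map.2 ⟨_, h, smul_inv_smul π b⟩

theorem smul_mem_permFinset {π : FinPerm 𝔸} {A : Finset 𝔸} {b : 𝔸} :
    π • b ∈ permFinset π A ↔ b ∈ A := by
  rw [mem_permFinset, inv_smul_smul]

theorem Fresh.smul {a : 𝔸} {x : X} (h : Fresh a x) (π : FinPerm 𝔸) : Fresh (π • a) (π • x) := by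
  obtain ⟨A, hA, ha⟩ := h
  refine ⟨permFinset π A, fun σ hσ => ?_, ?_⟩
  · have : (π⁻¹ * σ * π) • x = x := by
      apply hA
      intro b hb
      rw [mul_smul, mul_smul, hσ (a := π • b)]
      · simp
      · exact Finset.mem_coe.2 (smul_mem_permFinset.2 hb)
    rw [mul_smul, mul_smul, inv_smul_eq_iff] at this
    exact this
  · rwa [smul_mem_permFinset]

theorem fresh_smul_iff {a : 𝔸} {x : X} (π : FinPerm 𝔸) :
    Fresh (π • a) (π • x) ↔ Fresh a x :=
  ⟨fun h => by simpa using h.smul π⁻¹, fun h => h.smul π⟩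

theorem exists_not_mem [Infinite 𝔸] (A : Finset 𝔸) : ∃ c, c ∉ A :=
  Infinite.exists_notMem_finset A

/-- A name fresh for `x` and outside a given finite set. -/
theorem exists_fresh [Infinite 𝔸] (x : X) (C : Finset 𝔸) : ∃ c, Fresh c x ∧ c ∉ C := by
  classical
  obtain ⟨A, hA⟩ := NominalSet.exists_support (𝔸 := 𝔸) x
  obtain ⟨c, hc⟩ := exists_not_mem (A ∪ C)
  rw [Finset.mem_union, not_or] at hc
  exact ⟨c, ⟨A, hA, hc.1⟩, hc.2⟩

theorem Supports.union {A : Finset 𝔸} {x : X}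
    (h : MulAction.Supports (FinPerm 𝔸) (A : Set 𝔸) x) {B : Set 𝔸} (hB : (A : Set 𝔸) ⊆ B) :
    MulAction.Supports (FinPerm 𝔸) B x := fun π hπ => h π fun _ ha => hπ (hB ha)

theorem swp_smul_of_fresh [Infinite 𝔸] {a b : 𝔸} {x : X} (ha : Fresh a x) (hb : Fresh b x) :
    swp a b • x = x := by
  classical
  obtain ⟨A, hA, haA⟩ := ha
  obtain ⟨B, hB, hbB⟩ := hb
  by_cases hab : a = b
  · subst hab
    have : swp a a = (1 : FinPerm 𝔸) := Subtype.ext (Equiv.swap_self a)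
    rw [this, one_smul]
  obtain ⟨c, hc⟩ := exists_not_mem (A ∪ B ∪ {a, b})
  simp only [Finset.mem_union, Finset.mem_insert, Finset.mem_singleton, not_or] at hc
  obtain ⟨⟨hcA, hcB⟩, hca, hcb⟩ := hc
  have h1 : swp c a • x = x := hA _ (swp_fix hcA haA)
  have h2 : swp c b • x = x := hB _ (swp_fix hcB hbB)
  have h3 : swp a c • x = x := hA _ (swp_fix haA hcA)
  -- `(b c)(c a) = (b a)(c b)`
  have h4 := swp_mul (a := a) (c := c) (c' := b) hca (Ne.symm hab) hcb
  have h5 : (swp b c * swp c a) • x = x := by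
    rw [mul_smul, h1]; exact hB _ (swp_fix hbB hcB)
  rw [h4, mul_smul, h2] at h5
  have : swp a b = swp b a := Subtype.ext (Equiv.swap_comm a b)
  rw [this, h5]

theorem Fresh.map {F : X → W} (hF : ∀ (π : FinPerm 𝔸) x, F (π • x) = π • F x) {a : 𝔸} {x : X}
    (h : Fresh a x) : Fresh a (F x) := by
  obtain ⟨A, hA, ha⟩ := h
  exact ⟨A, fun π hπ => by rw [← hF, hA π hπ], ha⟩

theorem Fresh.of_map {F : X → W} (hF : ∀ (π : FinPerm 𝔸) x, F (π • x) = π • F x)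
    (hi : Function.Injective F) {a : 𝔸} {x : X} (h : Fresh a (F x)) : Fresh a x := by
  obtain ⟨A, hA, ha⟩ := h
  exact ⟨A, fun π hπ => hi (by rw [hF, hA π hπ]), ha⟩

end nominal

/-! ### Name abstraction -/

section nameAbs

/-- `α`-equivalence on `𝔸 × X`. -/
def Alpha {X : Type u} [NominalSet 𝔸 X] (s t : 𝔸 × X) : Prop :=
  ∃ c : 𝔸, c ≠ s.1 ∧ c ≠ t.1 ∧ Fresh c s.2 ∧ Fresh c t.2 ∧ swp c s.1 • s.2 = swp c t.1 • t.2

variable {X : Type u} [NominalSet 𝔸 X]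

theorem swp_change [Infinite 𝔸] {a c c' : 𝔸} {x : X} (h1 : c ≠ a) (h2 : c' ≠ a)
    (hc : Fresh c x) (hc' : Fresh c' x) :
    swp c' c • swp c a • x = swp c' a • x := by
  by_cases h3 : c = c'
  · subst h3
    have : swp c c = (1 : FinPerm 𝔸) := Subtype.ext (by classical exact Equiv.swap_self c)
    rw [this, one_smul]
  rw [← mul_smul, swp_mul h1 h2 h3, mul_smul, swp_smul_of_fresh hc hc']

/-- In `α`-equivalence any sufficiently fresh name may be used. -/
theorem Alpha.any [Infinite 𝔸] {s t : 𝔸 × X} (h : Alpha s t) {c : 𝔸} (h1 : c ≠ s.1) (h2 : c ≠ t.1)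
    (hs : Fresh c s.2) (ht : Fresh c t.2) : swp c s.1 • s.2 = swp c t.1 • t.2 := by
  obtain ⟨e, e1, e2, es, et, he⟩ := h
  rw [← swp_change e1 h1 es hs, he, swp_change e2 h2 et ht]

theorem exists_fresh₂ [Infinite 𝔸] {W : Type u} [NominalSet 𝔸 W] (x : X) (w : W) (C : Finset 𝔸) :
    ∃ c, Fresh c x ∧ Fresh c w ∧ c ∉ C := by
  classical
  obtain ⟨A, hA⟩ := NominalSet.exists_support (𝔸 := 𝔸) w
  obtain ⟨c, hc, hcC⟩ := exists_fresh x (A ∪ C)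
  rw [Finset.mem_union, not_or] at hcC
  exact ⟨c, hc, ⟨A, hA, hcC.1⟩, hcC.2⟩

theorem alpha_equivalence [Infinite 𝔸] : Equivalence (Alpha : 𝔸 × X → 𝔸 × X → Prop) where
  refl s := by
    obtain ⟨c, hc, hC⟩ := exists_fresh s.2 {s.1}
    have : c ≠ s.1 := by simpa using hC
    exact ⟨c, this, this, hc, hc, rfl⟩
  symm := fun ⟨c, h1, h2, h3, h4, h5⟩ => ⟨c, h2, h1, h4, h3, h5.symm⟩
  trans {s t r} hst htr := by
    classical
    obtain ⟨A, hA⟩ := NominalSet.exists_support (𝔸 := 𝔸) r.2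
    obtain ⟨c, hs, ht, hC⟩ := exists_fresh₂ s.2 t.2 (A ∪ {s.1, t.1, r.1})
    simp only [Finset.mem_union, Finset.mem_insert, Finset.mem_singleton, not_or] at hC
    obtain ⟨hcA, h1, h2, h3⟩ := hC
    have hr : Fresh c r.2 := ⟨A, hA, hcA⟩
    exact ⟨c, h1, h3, hs, hr, (hst.any h1 h2 hs ht).trans (htr.any h2 h3 ht hr)⟩

theorem Alpha.smul {s t : 𝔸 × X} (h : Alpha s t) (π : FinPerm 𝔸) :
    Alpha (π • s.1, π • s.2) (π • t.1, π • t.2) := by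
  have key : ∀ (c a : 𝔸) (x : X), swp (π • c) (π • a) • π • x = π • swp c a • x := by
    intro c a x
    have : swp (π • c) (π • a) * π = π * swp c a := by
      apply perm_ext
      intro b
      rw [mul_smul, mul_smul]
      by_cases e1 : b = c
      · rw [e1, swp_left, swp_left]
      by_cases e2 : b = a
      · rw [e2, swp_right, swp_right]
      rw [swp_of_ne e1 e2, swp_of_ne] <;> simpa using by assumption
    rw [← mul_smul, this, mul_smul]
  obtain ⟨c, h1, h2, h3, h4, h5⟩ := h
  refine ⟨π • c, by simpa using h1, by simpa using h2, h3.smul π, h4.smul π, ?_⟩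
  simp only [key, h5]

theorem alpha_swp [Infinite 𝔸] {a c : 𝔸} {x : X} (h : c ≠ a) (hc : Fresh c x) :
    Alpha (c, swp c a • x) (a, x) := by
  obtain ⟨e, he, he', hC⟩ := exists_fresh₂ (swp c a • x) x (by classical exact {a, c})
  simp only [Finset.mem_insert, Finset.mem_singleton, not_or] at hC
  exact ⟨e, hC.2, hC.1, he, he', swp_change h hC.1 hc he'⟩

variable (𝔸 X) in
/-- The name abstraction `[𝔸]X`. -/
def NameAbs [Infinite 𝔸] : Type u := Quotient (⟨Alpha, alpha_equivalence⟩ : Setoid (𝔸 × X))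

/-- The class `⟨a⟩x`. -/
def NameAbs.mk [Infinite 𝔸] (a : 𝔸) (x : X) : NameAbs 𝔸 X := Quotient.mk _ (a, x)

theorem NameAbs.mk_eq [Infinite 𝔸] {a b : 𝔸} {x y : X} :
    NameAbs.mk a x = NameAbs.mk b y ↔ Alpha (a, x) (b, y) := Quotient.eq

instance [Infinite 𝔸] : NominalSet 𝔸 (NameAbs 𝔸 X) where
  smul π := Quotient.map (fun s => (π • s.1, π • s.2)) fun _ _ h => h.smul π
  one_smul := by
    rintro ⟨a, x⟩
    change NameAbs.mk ((1 : FinPerm 𝔸) • a) ((1 : FinPerm 𝔸) • x) = NameAbs.mk a x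
    rw [one_smul, one_smul]
  mul_smul π σ := by
    rintro ⟨a, x⟩
    change NameAbs.mk ((π * σ) • a) ((π * σ) • x) = NameAbs.mk (π • σ • a) (π • σ • x)
    rw [mul_smul, mul_smul]
  exists_support := by
    classical
    rintro ⟨a, x⟩
    obtain ⟨A, hA⟩ := NominalSet.exists_support (𝔸 := 𝔸) x
    refine ⟨A ∪ {a}, fun π hπ => ?_⟩
    change NameAbs.mk (π • a) (π • x) = NameAbs.mk a x
    rw [hA π fun b hb => hπ (by simp [Finset.mem_coe.1 hb]), hπ (by simp)]

theorem NameAbs.smul_mk [Infinite 𝔸] (π : FinPerm 𝔸) (a : 𝔸) (x : X) :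
    π • NameAbs.mk a x = NameAbs.mk (π • a) (π • x) := rfl

end nameAbs

/-! ### 01-substitution sets -/

/-- A 01-substitution set. The two-element set is `Bool`, with `false` for `0` and `true` for
`1`; `sub x a i` is `x(a := i)`. -/
class SubstSet (𝔸 : Type u) (X : Type u) extends NominalSet 𝔸 X where
  sub : X → 𝔸 → Bool → X
  perm_sub : ∀ (π : FinPerm 𝔸) x a i, π • sub x a i = sub (π • x) (π • a) i
  fresh_sub : ∀ x a i, Fresh a (sub x a i)
  sub_of_fresh : ∀ x a i, Fresh a x → sub x a i = x
  sub_comm : ∀ x a a' i i', a ≠ a' → sub (sub x a i) a' i' = sub (sub x a' i') a i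

open SubstSet

theorem fresh_sub_of_fresh {X : Type u} [SubstSet 𝔸 X] {b : 𝔸} {x : X} (h : Fresh b x) (c : 𝔸)
    (i : Bool) : Fresh b (sub x c i) := by
  classical
  by_cases hbc : b = c
  · subst hbc; exact fresh_sub _ _ _
  obtain ⟨A, hA, hb⟩ := h
  refine ⟨insert c A, fun π hπ => ?_, by simp [hbc, hb]⟩
  rw [perm_sub, hA π fun a ha => hπ (by simp [Finset.mem_coe.1 ha]), hπ (by simp)]

/-- A bundled 01-substitution set: an object of the category `01Sub`. -/
structure Sub01 (𝔸 : Type u) : Type (u + 1) where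
  carrier : Type u
  [str : SubstSet 𝔸 carrier]

namespace Sub01

instance : CoeSort (Sub01 𝔸) (Type u) := ⟨carrier⟩

instance (X : Sub01 𝔸) : SubstSet 𝔸 X := X.str

/-- Morphisms of 01-substitution sets: equivariant maps preserving substitution. -/
@[ext]
structure Hom (X Y : Sub01 𝔸) : Type u where
  toFun : X → Y
  map_smul : ∀ (π : FinPerm 𝔸) x, toFun (π • x) = π • toFun x
  map_sub : ∀ x (a : 𝔸) i, toFun (sub x a i) = sub (toFun x) a i

instance : Category (Sub01 𝔸) where
  Hom := Hom
  id X := ⟨fun x => x, fun _ _ => rfl, fun _ _ _ => rfl⟩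
  comp f g := ⟨fun x => g.toFun (f.toFun x), fun π x => by rw [f.map_smul, g.map_smul],
    fun x a i => by rw [f.map_sub, g.map_sub]⟩

variable {X Y Z : Sub01 𝔸}

@[ext]
theorem hom_ext {f g : X ⟶ Y} (h : ∀ x, f.toFun x = g.toFun x) : f = g :=
  Hom.ext (funext h)

theorem id_apply (x : X) : (𝟙 X : X ⟶ X).toFun x = x := rfl

theorem comp_apply (f : X ⟶ Y) (g : Y ⟶ Z) (x : X) : (f ≫ g).toFun x = g.toFun (f.toFun x) := rfl

theorem congr_toFun {f g : X ⟶ Y} (h : f = g) (x : X) : f.toFun x = g.toFun x := by rw [h]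

end Sub01

/-! ### Open boxes -/

/-- A `d`-open box `(u, y)` over `p : Z ⟶ Y` (a 1-open box for `d = true`, a 0-open box for
`d = false`): an `(A, a)`-box has a face `u(b, i)` for all `(b, i)` in `A × 2` except `(a, d)`. -/
structure OpenBox (d : Bool) {Z Y : Sub01 𝔸} (p : Z ⟶ Y) : Type u where
  A : Finset 𝔸
  a : 𝔸
  mem : a ∈ A
  y : Y
  face : ∀ (b : 𝔸) (i : Bool), b ∈ A → (b, i) ≠ (a, d) → Z
  fresh : ∀ b i hb h, Fresh b (face b i hb h)
  adj : ∀ b i hb h b' i' hb' h', b ≠ b' →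
    sub (face b i hb h) b' i' = sub (face b' i' hb' h') b i
  isOver : ∀ b i hb h, p.toFun (face b i hb h) = sub y b i

namespace OpenBox

variable {d : Bool} {Z Y : Sub01 𝔸} {p : Z ⟶ Y}

theorem ext' {u v : OpenBox d p} (hA : u.A = v.A) (ha : u.a = v.a) (hy : u.y = v.y)
    (hf : ∀ b i hb h hb' h', u.face b i hb h = v.face b i hb' h') : u = v := by
  obtain ⟨A, a, _, y, face, _, _, _⟩ := u
  obtain ⟨A', a', _, y', face', _, _, _⟩ := v
  dsimp at hA ha hy
  subst hA ha hy
  have : face = face' := by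
    funext b i hb h
    exact hf b i hb h hb h
  subst this
  rfl

theorem face_congr (u : OpenBox d p) {b b' : 𝔸} {i : Bool} (e : b = b') (hb h hb' h') :
    u.face b i hb h = u.face b' i hb' h' := by subst e; rfl

theorem face_eq {u v : OpenBox d p} (e : u = v) (b i hb h hb' h') :
    u.face b i hb h = v.face b i hb' h' := by subst e; rfl

/-- The componentwise action of a permutation: `(π u)(b, i) = π (u(π⁻¹ b, i))`. -/
def perm (π : FinPerm 𝔸) (u : OpenBox d p) : OpenBox d p where
  A := permFinset π u.A
  a := π • u.a
  mem := smul_mem_permFinset.2 u.mem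
  y := π • u.y
  face b i hb h := π • u.face (π⁻¹ • b) i (mem_permFinset.1 hb) (by
    intro e
    simp only [Prod.mk.injEq, inv_smul_eq_iff] at e
    exact h (Prod.ext e.1 e.2))
  fresh b i hb h := by
    have := (u.fresh (π⁻¹ • b) i (mem_permFinset.1 hb) (by
      intro e
      simp only [Prod.mk.injEq, inv_smul_eq_iff] at e
      exact h (Prod.ext e.1 e.2))).smul π
    rwa [smul_inv_smul] at this
  adj b i hb h b' i' hb' h' hne := by
    have := congrArg (π • ·) (u.adj (π⁻¹ • b) i (mem_permFinset.1 hb) (by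
      intro e
      simp only [Prod.mk.injEq, inv_smul_eq_iff] at e
      exact h (Prod.ext e.1 e.2)) (π⁻¹ • b') i' (mem_permFinset.1 hb') (by
      intro e
      simp only [Prod.mk.injEq, inv_smul_eq_iff] at e
      exact h' (Prod.ext e.1 e.2)) (by simpa using hne))
    simp only [perm_sub, smul_inv_smul] at this
    exact this
  isOver b i hb h := by
    rw [p.map_smul, u.isOver, perm_sub, smul_inv_smul]

instance : MulAction (FinPerm 𝔸) (OpenBox d p) where
  smul := perm
  one_smul u := by
    refine ext' ?_ (one_smul _ _) (one_smul _ _) ?_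
    · ext b
      refine mem_permFinset.trans ?_
      rw [inv_one, one_smul]
    · intro b i hb h hb' h'
      refine (one_smul _ _).trans ?_
      exact u.face_congr (by rw [inv_one, one_smul]) _ _ _ _
  mul_smul π σ u := by
    refine ext' ?_ (mul_smul _ _ _) (mul_smul _ _ _) ?_
    · ext b
      refine mem_permFinset.trans ?_
      rw [mul_inv_rev, mul_smul]
      exact (mem_permFinset.trans mem_permFinset).symm
    · intro b i hb h hb' h'
      refine (mul_smul _ _ _).trans ?_
      refine congrArg (fun z => π • σ • z) ?_
      exact u.face_congr (by rw [mul_inv_rev, mul_smul]) _ _ _ _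

theorem smul_A (π : FinPerm 𝔸) (u : OpenBox d p) : (π • u).A = permFinset π u.A := rfl
theorem smul_a (π : FinPerm 𝔸) (u : OpenBox d p) : (π • u).a = π • u.a := rfl
theorem smul_y (π : FinPerm 𝔸) (u : OpenBox d p) : (π • u).y = π • u.y := rfl

theorem ne_smul (π : FinPerm 𝔸) {u : OpenBox d p} {b : 𝔸} {i : Bool} (h : (b, i) ≠ (u.a, d)) :
    (π • b, i) ≠ ((π • u).a, d) := by
  intro e
  simp only [smul_a, Prod.mk.injEq, smul_left_cancel_iff] at e
  exact h (Prod.ext e.1 e.2)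

theorem smul_face (π : FinPerm 𝔸) (u : OpenBox d p) (b : 𝔸) (i : Bool) (hb h hb' h') :
    (π • u).face (π • b) i hb' h' = π • u.face b i hb h :=
  congrArg (π • ·) (u.face_congr (inv_smul_smul π b) _ _ _ _)

instance : NominalSet 𝔸 (OpenBox d p) where
  exists_support u := by
    classical
    obtain ⟨S, hS⟩ := NominalSet.exists_support (𝔸 := 𝔸) u.y
    have : ∀ (b : 𝔸) (i : Bool), ∃ T : Finset 𝔸, ∀ hb h,
        MulAction.Supports (FinPerm 𝔸) (T : Set 𝔸) (u.face b i hb h) := by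
      intro b i
      by_cases hb : b ∈ u.A
      · by_cases h : (b, i) ≠ (u.a, d)
        · obtain ⟨T, hT⟩ := NominalSet.exists_support (𝔸 := 𝔸) (u.face b i hb h)
          exact ⟨T, fun _ _ => hT⟩
        · exact ⟨∅, fun _ h' => absurd h' h⟩
      · exact ⟨∅, fun h' => absurd h' hb⟩
    choose T hT using this
    refine ⟨u.A ∪ S ∪ u.A.biUnion fun b => T b false ∪ T b true, fun π hπ => ?_⟩
    have hA : ∀ b ∈ u.A, π • b = b := fun b hb => hπ (by simp [hb])
    have hmem : ∀ b, b ∈ permFinset π u.A ↔ b ∈ u.A := by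
      intro b
      have h2 : permFinset π u.A ⊆ u.A := by
        intro c hc
        obtain ⟨e, he, rfl⟩ := Finset.mem_map.1 hc
        change π • e ∈ u.A
        rwa [hA e he]
      refine ⟨fun h => h2 h, fun h => ?_⟩
      have := smul_mem_permFinset (π := π).2 h
      rwa [hA b h] at this
    refine ext' (Finset.ext hmem) (hA _ u.mem) (hS π fun a ha => hπ (by
      simp [Finset.mem_coe.1 ha])) ?_
    intro b i hb h hb' h'
    have e : π⁻¹ • b = b := by rw [inv_smul_eq_iff, hA b hb']
    refine (congrArg (π • ·) (u.face_congr e _ _ hb' h')).trans ?_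
    refine hT b i hb' h' π fun a ha => hπ ?_
    simp only [Finset.coe_union, Finset.coe_biUnion, Set.mem_union, Set.mem_iUnion]
    right
    refine ⟨b, hb', ?_⟩
    cases i
    · exact Or.inl ha
    · exact Or.inr ha

theorem ne_of_ne {c a : 𝔸} (h : c ≠ a) (i d : Bool) : (c, i) ≠ (a, d) :=
  fun e => h (congrArg Prod.fst e)

theorem mem_A_of_fresh [Infinite 𝔸] {u : OpenBox d p} {c : 𝔸} (h : Fresh c u) : c ∉ u.A := by
  intro hc
  classical
  obtain ⟨A, hA, hcA⟩ := h
  obtain ⟨e, he⟩ := exists_not_mem (A ∪ u.A)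
  rw [Finset.mem_union, not_or] at he
  have h1 : swp c e • u = u := hA _ (swp_fix hcA he.1)
  have h2 : swp c e • c ∈ (swp c e • u).A := smul_mem_permFinset.2 hc
  rw [h1, swp_left] at h2
  exact he.2 h2

theorem fresh_face {u : OpenBox d p} {c b : 𝔸} (hc : Fresh c u) (hcb : c ≠ b) (i : Bool) (hb h) :
    Fresh c (u.face b i hb h) := by
  classical
  obtain ⟨B, hB, hcB⟩ := hc
  refine ⟨B ∪ {b}, fun π hπ => ?_, by simp [hcB, hcb]⟩
  have h1 := hB π fun x hx => hπ (by simp [Finset.mem_coe.1 hx])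
  have h2 : π • b = b := hπ (by simp)
  have hb1 : π • b ∈ (π • u).A := smul_mem_permFinset.2 hb
  rw [← smul_face π u b i hb h hb1 (ne_smul π h)]
  exact (face_eq h1 _ _ _ _ (by rwa [h2]) (by rwa [h2])).trans (u.face_congr h2 _ _ _ _)

/-- The substitution `(u, y)(c := i)` for `c ∉ A`, defined componentwise. -/
def subst (u : OpenBox d p) (c : 𝔸) (i : Bool) (hc : c ∉ u.A) : OpenBox d p where
  A := u.A
  a := u.a
  mem := u.mem
  y := sub u.y c i
  face b j hb h := sub (u.face b j hb h) c i
  fresh b j hb h := fresh_sub_of_fresh (u.fresh b j hb h) c i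
  adj b j hb h b' j' hb' h' hne := by
    have h1 : c ≠ b := fun e => hc (e ▸ hb)
    have h2 : c ≠ b' := fun e => hc (e ▸ hb')
    rw [sub_comm _ _ _ _ _ h2, u.adj b j hb h b' j' hb' h' hne, sub_comm _ _ _ _ _ h1.symm]
  isOver b j hb h := by
    have h1 : c ≠ b := fun e => hc (e ▸ hb)
    rw [p.map_sub, u.isOver, sub_comm _ _ _ _ _ h1.symm]

theorem smul_subst (π : FinPerm 𝔸) (u : OpenBox d p) (c : 𝔸) (i : Bool) (hc : c ∉ u.A) (hc') :
    π • u.subst c i hc = (π • u).subst (π • c) i hc' := by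
  refine ext' rfl rfl (perm_sub _ _ _ _) ?_
  intro b j hb h hb' h'
  exact perm_sub _ _ _ _

theorem subst_of_fresh {u : OpenBox d p} {c : 𝔸} (i : Bool) (h : Fresh c u) (hc) :
    u.subst c i hc = u := by
  refine ext' rfl rfl (sub_of_fresh _ _ _ (h.map (F := y) fun _ _ => rfl)) ?_
  intro b k hb h1 hb' h'
  exact sub_of_fresh _ _ _ (fresh_face h (fun e' => hc (e' ▸ hb')) _ _ _)

/-- The image of an open box under a commutative square. -/
def map {Z' Y' : Sub01 𝔸} {p' : Z' ⟶ Y'} (h : Z ⟶ Z') (k : Y ⟶ Y') (w : h ≫ p' = p ≫ k)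
    (u : OpenBox d p) : OpenBox d p' where
  A := u.A
  a := u.a
  mem := u.mem
  y := k.toFun u.y
  face b i hb hh := h.toFun (u.face b i hb hh)
  fresh b i hb hh := (u.fresh b i hb hh).map h.map_smul
  adj b i hb hh b' i' hb' hh' hne := by
    rw [← h.map_sub, ← h.map_sub, u.adj b i hb hh b' i' hb' hh' hne]
  isOver b i hb hh := by
    have := Sub01.congr_toFun w (u.face b i hb hh)
    rw [Sub01.comp_apply, Sub01.comp_apply, u.isOver, k.map_sub] at this
    exact this

section map

variable {Z' Y' : Sub01 𝔸} {p' : Z' ⟶ Y'} {h : Z ⟶ Z'} {k : Y ⟶ Y'} {w : h ≫ p' = p ≫ k}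

theorem map_smul (π : FinPerm 𝔸) (u : OpenBox d p) :
    (π • u).map h k w = π • u.map h k w := by
  refine ext' rfl rfl (k.map_smul _ _) ?_
  intro b i hb hh hb' hh'
  exact h.map_smul _ _

theorem map_subst (u : OpenBox d p) (c : 𝔸) (i : Bool) (hc : c ∉ u.A) :
    (u.subst c i hc).map h k w = (u.map h k w).subst c i hc := by
  refine ext' rfl rfl (k.map_sub _ _ _) ?_
  intro b j hb hh hb' hh'
  exact h.map_sub _ _ _

theorem map_injective (hh : Function.Injective h.toFun) (hk : Function.Injective k.toFun) :
    Function.Injective (map (d := d) h k w) := by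
  intro u v e
  refine ext' (congrArg A e :) (congrArg a e :) (hk (congrArg y e :)) ?_
  intro b i hb h1 hb' h'
  exact hh (face_eq e b i hb h1 hb' h')

theorem map_id (u : OpenBox d p) (w') : u.map (𝟙 Z) (𝟙 Y) w' = u := rfl

theorem map_map {Z₂ Y₂ : Sub01 𝔸} {p₂ : Z₂ ⟶ Y₂} (h' : Z' ⟶ Z₂) (k' : Y' ⟶ Y₂) (w') (w'')
    (u : OpenBox d p) :
    (u.map h k w).map h' k' w' = u.map (p' := p₂) (h ≫ h') (k ≫ k') w'' := rfl

end map

end OpenBox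

/-- `x` is a filler of the open box `u`. -/
structure IsFiller {d : Bool} {Z Y : Sub01 𝔸} {p : Z ⟶ Y} (u : OpenBox d p) (x : Z) : Prop where
  face : ∀ b i hb h, sub x b i = u.face b i hb h
  isOver : p.toFun x = u.y

/-- A uniform Kan filling operator for `d`-open boxes over `p`. -/
@[ext]
structure KanFilling (d : Bool) {Z Y : Sub01 𝔸} (p : Z ⟶ Y) : Type u where
  fill : OpenBox d p → Z
  isFiller : ∀ u, IsFiller u (fill u)
  fill_smul : ∀ (π : FinPerm 𝔸) u, fill (π • u) = π • fill u
  fill_subst : ∀ u c i (hc : c ∉ u.A), fill (u.subst c i hc) = sub (fill u) c i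

/-! ### Kan compositions -/

section comp

variable [Infinite 𝔸] {d : Bool} {Z Y : Sub01 𝔸} {p : Z ⟶ Y}

/-- Freely added Kan compositions: the subset of `[𝔸](OpenBox d p)` consisting of the
`⟨a⟩(u, y)` with `(u, y)` an `(A, a)`-box for some `A`. -/
def Comp (d : Bool) {Z Y : Sub01 𝔸} (p : Z ⟶ Y) : Type u :=
  Set.range fun u : OpenBox d p => NameAbs.mk u.a u

/-- `⟨a⟩(u, y)`. -/
def Comp.mk (u : OpenBox d p) : Comp d p := ⟨NameAbs.mk u.a u, u, rfl⟩

theorem Comp.exists_rep (w : Comp d p) : ∃ u, Comp.mk u = w := by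
  obtain ⟨_, u, rfl⟩ := w
  exact ⟨u, rfl⟩

theorem Comp.mk_eq {u v : OpenBox d p} : Comp.mk u = Comp.mk v ↔ Alpha (u.a, u) (v.a, v) :=
  Subtype.ext_iff.trans NameAbs.mk_eq

instance : MulAction (FinPerm 𝔸) (Comp d p) where
  smul π w := ⟨π • w.1, by
    obtain ⟨_, u, rfl⟩ := w
    exact ⟨π • u, rfl⟩⟩
  one_smul w := Subtype.ext (one_smul _ w.1)
  mul_smul π σ w := Subtype.ext (mul_smul π σ w.1)

theorem Comp.smul_mk (π : FinPerm 𝔸) (u : OpenBox d p) : π • Comp.mk u = Comp.mk (π • u) := rfl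

instance : NominalSet 𝔸 (Comp d p) where
  exists_support w := by
    obtain ⟨A, hA⟩ := NominalSet.exists_support (𝔸 := 𝔸) w.1
    exact ⟨A, fun π hπ => Subtype.ext (hA π hπ)⟩

theorem Comp.fresh_mk (u : OpenBox d p) : Fresh u.a (Comp.mk u) := by
  obtain ⟨c, hc, hC⟩ := exists_fresh u {u.a}
  have hca : c ≠ u.a := by simpa using hC
  have e : Comp.mk (swp c u.a • u) = Comp.mk u := by
    rw [Comp.mk_eq, OpenBox.smul_a, swp_right]
    exact alpha_swp hca hc
  obtain ⟨A, hA, hcA⟩ : Fresh c (Comp.mk u) := hc.map fun _ _ => rfl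
  have := (Fresh.smul (π := swp c u.a) (a := c) (x := Comp.mk u) ⟨A, hA, hcA⟩)
  rwa [swp_left, Comp.smul_mk, e] at this

/-- Every element is `⟨a⟩(u, y)` for some `a` avoiding a given finite set. -/
theorem Comp.exists_rep_avoid (w : Comp d p) (C : Finset 𝔸) : ∃ u, Comp.mk u = w ∧ u.a ∉ C := by
  classical
  obtain ⟨u, rfl⟩ := w.exists_rep
  obtain ⟨c, hc, hC⟩ := exists_fresh u (insert u.a C)
  rw [Finset.mem_insert, not_or] at hC
  refine ⟨swp c u.a • u, ?_, ?_⟩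
  · rw [Comp.mk_eq, OpenBox.smul_a, swp_right]
    exact alpha_swp hC.1 hc
  · rw [OpenBox.smul_a, swp_right]
    exact hC.2

/-- A function on open boxes that is supported by `C` and satisfies the freshness condition
takes the same value on all representatives avoiding `C`. -/
theorem Comp.unique {W : Type u} [NominalSet 𝔸 W] (F : OpenBox d p → W) (C : Finset 𝔸)
    (hF : ∀ π : FinPerm 𝔸, (∀ c ∈ C, π • c = c) → ∀ u, u.a ∉ C → F (π • u) = π • F u)
    (hfr : ∀ u, u.a ∉ C → Fresh u.a (F u)) {u v : OpenBox d p} (h : Comp.mk u = Comp.mk v)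
    (hu : u.a ∉ C) (hv : v.a ∉ C) : F u = F v := by
  classical
  obtain ⟨c, hcu, hcv, hC⟩ := exists_fresh₂ u v (C ∪ {u.a, v.a})
  simp only [Finset.mem_union, Finset.mem_insert, Finset.mem_singleton, not_or] at hC
  obtain ⟨hcC, hca, hca'⟩ := hC
  have key : ∀ u : OpenBox d p, Fresh c u → u.a ∉ C → F u = F (swp c u.a • u) := by
    intro u hcu hu
    rw [hF _ (swp_fix hcC hu) u hu]
    obtain ⟨B, hB, hcB⟩ := hcu
    refine (swp_smul_of_fresh ⟨B ∪ C, fun π hπ => ?_, ?_⟩ (hfr u hu)).symm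
    · rw [← hF π (fun c hc => hπ (by simp [hc])) u hu,
        hB π fun b hb => hπ (by simp [Finset.mem_coe.1 hb])]
    · simp [hcB, hcC]
  rw [key u hcu hu, key v hcv hv, (Comp.mk_eq.1 h).any hca hca' hcu hcv]

/-- A function on open boxes, read on a representative of `w` avoiding `C`. -/
noncomputable def Comp.elim {W : Type u} (F : OpenBox d p → W) (C : Finset 𝔸) (w : Comp d p) : W :=
  F (w.exists_rep_avoid C).choose

theorem Comp.elim_mk {W : Type u} [NominalSet 𝔸 W] (F : OpenBox d p → W) (C : Finset 𝔸)
    (hF : ∀ π : FinPerm 𝔸, (∀ c ∈ C, π • c = c) → ∀ u, u.a ∉ C → F (π • u) = π • F u)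
    (hfr : ∀ u, u.a ∉ C → Fresh u.a (F u)) (u : OpenBox d p) (hu : u.a ∉ C) :
    Comp.elim F C (Comp.mk u) = F u :=
  Comp.unique F C hF hfr ((Comp.mk u).exists_rep_avoid C).choose_spec.1
    ((Comp.mk u).exists_rep_avoid C).choose_spec.2 hu

variable {Z' Y' : Sub01 𝔸} {p' : Z' ⟶ Y'}

/-- The image of Kan compositions under a commutative square. -/
noncomputable def Comp.map (h : Z ⟶ Z') (k : Y ⟶ Y') (w : h ≫ p' = p ≫ k) :
    Comp d p → Comp d p' :=
  Comp.elim (fun u => Comp.mk (u.map h k w)) ∅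

theorem Comp.map_mk (h : Z ⟶ Z') (k : Y ⟶ Y') (w : h ≫ p' = p ≫ k) (u : OpenBox d p) :
    Comp.map h k w (Comp.mk u) = Comp.mk (u.map h k w) := by
  refine Comp.elim_mk _ ∅ ?_ ?_ u (by simp)
  · intro π _ u _
    rw [OpenBox.map_smul, Comp.smul_mk]
  · intro u _
    exact Comp.fresh_mk (u.map h k w)

theorem Comp.map_smul (h : Z ⟶ Z') (k : Y ⟶ Y') (w : h ≫ p' = p ≫ k) (π : FinPerm 𝔸)
    (x : Comp d p) : Comp.map h k w (π • x) = π • Comp.map h k w x := by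
  obtain ⟨u, rfl⟩ := x.exists_rep
  rw [Comp.smul_mk, Comp.map_mk, Comp.map_mk, Comp.smul_mk, OpenBox.map_smul]

theorem Comp.map_injective (h : Z ⟶ Z') (k : Y ⟶ Y') (w : h ≫ p' = p ≫ k)
    (hh : Function.Injective h.toFun) (hk : Function.Injective k.toFun) :
    Function.Injective (Comp.map (d := d) h k w) := by
  intro x x' e
  obtain ⟨u, rfl⟩ := x.exists_rep
  obtain ⟨v, rfl⟩ := x'.exists_rep
  rw [Comp.map_mk, Comp.map_mk, Comp.mk_eq] at e
  obtain ⟨c, h1, h2, h3, h4, h5⟩ := e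
  rw [Comp.mk_eq]
  have hm : ∀ (π : FinPerm 𝔸) (u : OpenBox d p), (π • u).map h k w = π • u.map h k w :=
    OpenBox.map_smul
  refine ⟨c, h1, h2, h3.of_map hm (OpenBox.map_injective hh hk),
    h4.of_map hm (OpenBox.map_injective hh hk), OpenBox.map_injective hh hk (w := w) ?_⟩
  rw [hm, hm]
  exact h5

end comp

/-! ### One step of the construction -/

section step

variable [Infinite 𝔸]

/-- The underlying set of one step: for `f : X ⟶ Y` and `p : Z ⟶ Y` it is the coproduct of `X`,
of the open boxes over `p`, and of the Kan compositions of such boxes. For `d = true` the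
components `fill d` and `comp d` are `K↑` and `K⁺`, for `d = false` they are `K↓` and `K⁻`. -/
inductive Step (f : Arrow (Sub01 𝔸)) {Z : Sub01 𝔸} (p : Z ⟶ f.right) : Type u
  | base (x : f.left)
  | fill (d : Bool) (u : OpenBox d p)
  | comp (d : Bool) (w : Comp d p)

namespace Step

variable {f : Arrow (Sub01 𝔸)} {Z : Sub01 𝔸} {p : Z ⟶ f.right}

/-- The componentwise action. -/
def perm (π : FinPerm 𝔸) : Step f p → Step f p
  | base x => base (π • x)
  | fill d u => fill d (π • u)
  | comp d w => comp d (π • w)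

instance : MulAction (FinPerm 𝔸) (Step f p) where
  smul := perm
  one_smul s := by
    cases s with
    | base x => exact congrArg base (one_smul _ x)
    | fill d u => exact congrArg (fill d) (one_smul _ u)
    | comp d w => exact congrArg (comp d) (one_smul _ w)
  mul_smul π σ s := by
    cases s with
    | base x => exact congrArg base (mul_smul π σ x)
    | fill d u => exact congrArg (fill d) (mul_smul π σ u)
    | comp d w => exact congrArg (comp d) (mul_smul π σ w)

theorem smul_base (π : FinPerm 𝔸) (x : f.left) :
    π • (base x : Step f p) = base (π • x) := rfl
theorem smul_fill (π : FinPerm 𝔸) {d : Bool} (u : OpenBox d p) :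
    π • (fill d u : Step f p) = fill d (π • u) := rfl
theorem smul_comp (π : FinPerm 𝔸) {d : Bool} (w : Comp d p) :
    π • (comp d w : Step f p) = comp d (π • w) := rfl

instance : NominalSet 𝔸 (Step f p) where
  exists_support s := by
    cases s with
    | base x =>
      obtain ⟨A, hA⟩ := NominalSet.exists_support (𝔸 := 𝔸) x
      exact ⟨A, fun π hπ => by rw [smul_base, hA π hπ]⟩
    | fill d u =>
      obtain ⟨A, hA⟩ := NominalSet.exists_support (𝔸 := 𝔸) u
      exact ⟨A, fun π hπ => by rw [smul_fill, hA π hπ]⟩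
    | comp d w =>
      obtain ⟨A, hA⟩ := NominalSet.exists_support (𝔸 := 𝔸) w
      exact ⟨A, fun π hπ => by rw [smul_comp, hA π hπ]⟩

open scoped Classical in
/-- The substitution `(u, y)(c := i)`, where `j` is the inclusion of the previous stage. -/
noncomputable def fillSub (j : Z → Step f p) {d : Bool} (u : OpenBox d p) (c : 𝔸) (i : Bool) :
    Step f p :=
  if hc : c ∈ u.A then
    if h : (c, i) ≠ (u.a, d) then j (u.face c i hc h) else comp d (Comp.mk u)
  else fill d (u.subst c i hc)

open scoped Classical in
/-- The substitution `(⟨a⟩(u, y))(c := i)` for `a ≠ c`, where `j` is the inclusion of the previous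
stage. -/
noncomputable def compSub (j : Z → Step f p) {d : Bool} (c : 𝔸) (i : Bool) (u : OpenBox d p) :
    Step f p :=
  if hc : c ∈ u.A then
    if h : (c, i) ≠ (u.a, d) then j (sub (u.face c i hc h) u.a d) else comp d (Comp.mk u)
  else comp d (Comp.mk (u.subst c i hc))

/-- The substitution operation on a step; for `⟨a⟩(u, y)(c := i)` a representative with `a ≠ c`
is used. -/
noncomputable def subst (j : Z → Step f p) : Step f p → 𝔸 → Bool → Step f p
  | base x, c, i => base (sub x c i)
  | fill _ u, c, i => fillSub j u c i
  | comp _ w, c, i => Comp.elim (compSub j c i) {c} w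

/-- The map of a step to `Y`. -/
noncomputable def toRight : Step f p → f.right
  | base x => f.hom.toFun x
  | fill _ u => u.y
  | comp d w => Comp.elim (fun u => sub u.y u.a d) ∅ w

theorem toRight_comp {d : Bool} (u : OpenBox d p) :
    toRight (comp d (Comp.mk u) : Step f p) = sub u.y u.a d := by
  refine Comp.elim_mk (fun u : OpenBox d p => sub u.y u.a d) ∅ ?_ ?_ u (by simp)
  · intro π _ u _
    exact (perm_sub π u.y u.a d).symm
  · intro u _
    exact fresh_sub _ _ _

theorem toRight_smul (π : FinPerm 𝔸) (s : Step f p) : toRight (π • s) = π • toRight s := by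
  cases s with
  | base x => exact f.hom.map_smul π x
  | fill d u => rfl
  | comp d w =>
    obtain ⟨u, rfl⟩ := w.exists_rep
    rw [smul_comp, Comp.smul_mk, toRight_comp, toRight_comp, perm_sub]
    rfl

section face

variable (j : Z → Step f p) {d : Bool} (u : OpenBox d p)

theorem subst_fill_face {c : 𝔸} {i : Bool} (hc : c ∈ u.A) (h : (c, i) ≠ (u.a, d)) :
    subst j (fill d u) c i = j (u.face c i hc h) :=
  (dif_pos hc).trans (dif_pos h)

theorem subst_fill_self : subst j (fill d u) u.a d = comp d (Comp.mk u) :=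
  (dif_pos u.mem).trans (dif_neg (by simp))

theorem subst_fill_of_notMem {c : 𝔸} {i : Bool} (hc : c ∉ u.A) :
    subst j (fill d u) c i = fill d (u.subst c i hc) := dif_neg hc

theorem compSub_face {c : 𝔸} {i : Bool} (hc : c ∈ u.A) (h : (c, i) ≠ (u.a, d)) :
    compSub j c i u = j (sub (u.face c i hc h) u.a d) :=
  (dif_pos hc).trans (dif_pos h)

theorem compSub_of_notMem {c : 𝔸} {i : Bool} (hc : c ∉ u.A) :
    compSub j c i u = comp d (Comp.mk (u.subst c i hc)) := dif_neg hc

variable {j}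

theorem subst_comp (hj : ∀ (π : FinPerm 𝔸) z, j (π • z) = π • j z)
    {c : 𝔸} {i : Bool} (hne : c ≠ u.a) :
    subst j (comp d (Comp.mk u)) c i = compSub j c i u := by
  refine Comp.elim_mk (compSub j c i) {c} ?_ ?_ u (by simpa using hne.symm)
  · intro π hπ u hu
    have hπc : π • c = c := hπ c (by simp)
    have hca : c ≠ u.a := fun e => hu (by simp [e])
    have hmem : c ∈ (π • u).A ↔ c ∈ u.A := by
      conv_lhs => rw [← hπc]
      exact smul_mem_permFinset
    by_cases hc : c ∈ u.A
    · have h : (c, i) ≠ (u.a, d) := fun e => hca (congrArg Prod.fst e)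
      have h' : (c, i) ≠ ((π • u).a, d) := by
        have := OpenBox.ne_smul π h
        rwa [hπc] at this
      rw [compSub_face j u hc h, compSub_face j _ (hmem.2 hc) h', ← hj, perm_sub]
      congr 2
      have h3 : (π • c, i) ≠ ((π • u).a, d) := OpenBox.ne_smul π h
      rw [← OpenBox.smul_face π u c i hc h (smul_mem_permFinset.2 hc) h3]
      exact (π • u).face_congr hπc.symm _ _ _ _
    · rw [compSub_of_notMem j u hc, compSub_of_notMem j _ (fun h => hc (hmem.1 h)), smul_comp,
        Comp.smul_mk]
      congr 2
      rw [OpenBox.smul_subst π u c i hc (fun h => hc (smul_mem_permFinset.1 h))]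
      congr 1
      exact hπc.symm
  · intro u hu
    have hca : c ≠ u.a := fun e => hu (by simp [e])
    by_cases hc : c ∈ u.A
    · have h : (c, i) ≠ (u.a, d) := fun e => hca (congrArg Prod.fst e)
      rw [compSub_face j u hc h]
      exact (fresh_sub _ _ _).map hj
    · rw [compSub_of_notMem j u hc]
      exact (Comp.fresh_mk (u.subst c i hc)).map (F := fun w => (comp d w : Step f p))
        fun _ _ => rfl

theorem subst_comp_face (hj : ∀ (π : FinPerm 𝔸) z, j (π • z) = π • j z)
    {c : 𝔸} {i : Bool} (hne : c ≠ u.a) (hc : c ∈ u.A)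
    (h : (c, i) ≠ (u.a, d)) :
    subst j (comp d (Comp.mk u)) c i = j (sub (u.face c i hc h) u.a d) := by
  rw [subst_comp u hj hne, compSub_face j u hc h]

theorem subst_comp_of_notMem (hj : ∀ (π : FinPerm 𝔸) z, j (π • z) = π • j z)
    {c : 𝔸} {i : Bool} (hc : c ∉ u.A) :
    subst j (comp d (Comp.mk u)) c i = comp d (Comp.mk (u.subst c i hc)) := by
  rw [subst_comp u hj (fun e => hc (by rw [e]; exact u.mem)), compSub_of_notMem j u hc]

end face

section axioms

variable {j : Z → Step f p}

theorem smul_subst (hj : ∀ (π : FinPerm 𝔸) z, j (π • z) = π • j z)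
    (π : FinPerm 𝔸) (s : Step f p) (c : 𝔸) (i : Bool) :
    π • subst j s c i = subst j (π • s) (π • c) i := by
  cases s with
  | base x => exact congrArg base (perm_sub π x c i)
  | fill d u =>
    rw [smul_fill]
    by_cases hc : c ∈ u.A
    · have hc' : π • c ∈ (π • u).A := smul_mem_permFinset.2 hc
      by_cases h : (c, i) ≠ (u.a, d)
      · rw [subst_fill_face j u hc h, subst_fill_face j _ hc' (OpenBox.ne_smul π h), ← hj,
          OpenBox.smul_face π u c i hc h]
      · simp only [ne_eq, not_not, Prod.mk.injEq] at h
        obtain ⟨rfl, rfl⟩ := h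
        rw [subst_fill_self]
        exact (subst_fill_self j (π • u)).symm
    · have hc' : π • c ∉ (π • u).A := fun h => hc (smul_mem_permFinset.1 h)
      rw [subst_fill_of_notMem j u hc, subst_fill_of_notMem j _ hc', smul_fill,
        OpenBox.smul_subst π u c i hc hc']
  | comp d w =>
    obtain ⟨u, rfl, hu⟩ := w.exists_rep_avoid {c}
    have hca : c ≠ u.a := fun e => hu (by simp [e])
    have hca' : π • c ≠ (π • u).a := fun e => hca (smul_left_cancel π e)
    rw [smul_comp, Comp.smul_mk]
    by_cases hc : c ∈ u.A
    · have hc' : π • c ∈ (π • u).A := smul_mem_permFinset.2 hc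
      have h := OpenBox.ne_of_ne hca i d
      rw [subst_comp_face u hj hca hc h, subst_comp_face _ hj hca' hc' (OpenBox.ne_smul π h), ← hj,
        perm_sub, OpenBox.smul_face π u c i hc h]
      rfl
    · have hc' : π • c ∉ (π • u).A := fun h => hc (smul_mem_permFinset.1 h)
      rw [subst_comp_of_notMem u hj hc, subst_comp_of_notMem _ hj hc', smul_comp, Comp.smul_mk,
        OpenBox.smul_subst π u c i hc hc']

theorem fresh_subst (hj : ∀ (π : FinPerm 𝔸) z, j (π • z) = π • j z)
    (s : Step f p) (c : 𝔸) (i : Bool) : Fresh c (subst j s c i) := by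
  have hS : ∀ {d : Bool} (u : OpenBox d p) (hc : c ∉ u.A), Fresh c (u.subst c i hc) := by
    intro d u hc
    -- take `e` fresh for `u`; the box `(c e) • u` has the same substitution instance
    obtain ⟨A, hA⟩ := NominalSet.exists_support (𝔸 := 𝔸) (u.subst c i hc)
    classical
    obtain ⟨e, he, hC⟩ := exists_fresh u (insert c A)
    rw [Finset.mem_insert, not_or] at hC
    have heA := OpenBox.mem_A_of_fresh he
    have hfix : ∀ b ∈ u.A, swp e c • b = b := fun b hb =>
      swp_of_ne (fun e' => heA (e' ▸ hb)) (fun e' => hc (e' ▸ hb))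
    have hinv : ∀ b ∈ u.A, (swp e c)⁻¹ • b = b := fun b hb => by
      rw [inv_smul_eq_iff, hfix b hb]
    have key : ∀ {W : Type u} [SubstSet 𝔸 W] (x : W), Fresh e (sub x c i) →
        swp e c • sub x c i = sub x c i := fun x hx => swp_smul_of_fresh hx (fresh_sub _ _ _)
    have heq : swp e c • u.subst c i hc = u.subst c i hc := by
      refine OpenBox.ext' ?_ (hfix _ u.mem) ?_ ?_
      · ext b
        constructor
        · intro h
          have hb := mem_permFinset.1 h
          have := hfix _ hb
          rw [smul_inv_smul] at this
          rwa [← this] at hb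
        · intro h
          refine mem_permFinset.2 ?_
          rwa [hinv b h]
      · exact key u.y (fresh_sub_of_fresh (he.map (F := OpenBox.y) fun _ _ => rfl) c i)
      · intro b k hb h hb' h'
        refine (congrArg (swp e c • ·) ((u.subst c i hc).face_congr (hinv b hb') _ _ hb' h')).trans
          ?_
        refine key _ (fresh_sub_of_fresh ?_ c i)
        exact OpenBox.fresh_face he (fun e' => heA (e' ▸ hb')) _ _ _
    have : Fresh e (u.subst c i hc) := ⟨A, hA, hC.2⟩
    have := this.smul (swp e c)
    rwa [swp_left, heq] at this
  cases s with
  | base x => exact (fresh_sub x c i).map (F := fun x => (base x : Step f p)) fun _ _ => rfl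
  | fill d u =>
    by_cases hc : c ∈ u.A
    · by_cases h : (c, i) ≠ (u.a, d)
      · rw [subst_fill_face j u hc h]
        exact (u.fresh c i hc h).map hj
      · simp only [ne_eq, not_not, Prod.mk.injEq] at h
        obtain ⟨rfl, rfl⟩ := h
        rw [subst_fill_self]
        exact (Comp.fresh_mk u).map (F := fun w => (comp i w : Step f p)) fun _ _ => rfl
    · rw [subst_fill_of_notMem j u hc]
      exact (hS u hc).map (F := fun w => (fill d w : Step f p)) fun _ _ => rfl
  | comp d w =>
    obtain ⟨u, rfl, hu⟩ := w.exists_rep_avoid {c}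
    have hca : c ≠ u.a := fun e => hu (by simp [e])
    by_cases hc : c ∈ u.A
    · have h := OpenBox.ne_of_ne hca i d
      rw [subst_comp_face u hj hca hc h]
      exact (fresh_sub_of_fresh (u.fresh c i hc h) _ _).map hj
    · rw [subst_comp_of_notMem u hj hc]
      exact (hS u hc).map (F := fun w => (comp d (Comp.mk w) : Step f p)) fun _ _ => rfl

theorem subst_of_fresh (hj : ∀ (π : FinPerm 𝔸) z, j (π • z) = π • j z)
    (s : Step f p) (c : 𝔸) (i : Bool) (h : Fresh c s) : subst j s c i = s := by
  -- it suffices to treat a permuted copy of `s` for which `c` is visibly fresh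
  obtain ⟨A, hA, hcA⟩ := h
  cases s with
  | base x =>
    have : Fresh c x := ⟨A, fun π hπ => Step.base.inj (hA π hπ), hcA⟩
    exact congrArg base (sub_of_fresh x c i this)
  | fill d u =>
    have : Fresh c u := ⟨A, fun π hπ => eq_of_heq (Step.fill.inj (hA π hπ)).2, hcA⟩
    rw [subst_fill_of_notMem j u (OpenBox.mem_A_of_fresh this), OpenBox.subst_of_fresh i this]
  | comp d w =>
    have hw : Fresh c w := ⟨A, fun π hπ => eq_of_heq (Step.comp.inj (hA π hπ)).2, hcA⟩
    obtain ⟨u, rfl⟩ := w.exists_rep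
    -- rename `c` by a name fresh for everything
    obtain ⟨e, heu, -⟩ := exists_fresh u (∅ : Finset 𝔸)
    have hew : Fresh e (Comp.mk u) := heu.map fun _ _ => rfl
    have h1 : swp e c • Comp.mk u = Comp.mk u := swp_smul_of_fresh hew hw
    have h2 : Fresh c (swp e c • u) := by
      have := heu.smul (swp e c)
      rwa [swp_left] at this
    rw [← h1, Comp.smul_mk, subst_comp_of_notMem _ hj (OpenBox.mem_A_of_fresh h2),
      OpenBox.subst_of_fresh i h2]

theorem subst_comm (hj : ∀ (π : FinPerm 𝔸) z, j (π • z) = π • j z)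
    (hs : ∀ z c i, j (sub z c i) = subst j (j z) c i) (s : Step f p) (c c' : 𝔸) (i i' : Bool) (hne : c ≠ c') :
    subst j (subst j s c i) c' i' = subst j (subst j s c' i') c i := by
  -- the case of a missing face
  have hmiss : ∀ {d : Bool} (u : OpenBox d p) (c : 𝔸) (i : Bool), u.a ≠ c →
      subst j (subst j (fill d u) u.a d) c i = subst j (subst j (fill d u) c i) u.a d := by
    intro d u c i hac
    rw [subst_fill_self]
    by_cases hc : c ∈ u.A
    · have h := OpenBox.ne_of_ne hac.symm i d
      rw [subst_comp_face u hj hac.symm hc h, subst_fill_face j u hc h, hs]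
    · rw [subst_comp_of_notMem u hj hc, subst_fill_of_notMem j u hc]
      exact (subst_fill_self j (u.subst c i hc)).symm
  have hface : ∀ {d : Bool} (u : OpenBox d p) (c c' : 𝔸) (i i' : Bool) (hc : c ∈ u.A)
      (h : (c, i) ≠ (u.a, d)) (_ : c' ∉ u.A),
      subst j (subst j (fill d u) c i) c' i' = subst j (subst j (fill d u) c' i') c i := by
    intro d u c c' i i' hc h hc'
    rw [subst_fill_face j u hc h, subst_fill_of_notMem j u hc', ← hs]
    exact (subst_fill_face j (u.subst c' i' hc') hc h).symm
  have hboth : ∀ {d : Bool} (u : OpenBox d p) (hc : c ∉ u.A) (hc' : c' ∉ u.A),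
      (u.subst c i hc).subst c' i' hc' = (u.subst c' i' hc').subst c i hc := by
    intro d u hc hc'
    exact OpenBox.ext' rfl rfl (sub_comm _ _ _ _ _ hne) fun b k hb h _ _ => sub_comm _ _ _ _ _ hne
  cases s with
  | base x => exact congrArg base (sub_comm x c c' i i' hne)
  | fill d u =>
    by_cases hc : c ∈ u.A
    · by_cases h : (c, i) ≠ (u.a, d)
      · by_cases hc' : c' ∈ u.A
        · by_cases h' : (c', i') ≠ (u.a, d)
          · rw [subst_fill_face j u hc h, subst_fill_face j u hc' h', ← hs, ← hs,
              u.adj c i hc h c' i' hc' h' hne]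
          · simp only [ne_eq, not_not, Prod.mk.injEq] at h'
            obtain ⟨rfl, rfl⟩ := h'
            exact (hmiss u c i hne.symm).symm
        · exact hface u c c' i i' hc h hc'
      · simp only [ne_eq, not_not, Prod.mk.injEq] at h
        obtain ⟨rfl, rfl⟩ := h
        exact hmiss u c' i' hne
    · by_cases hc' : c' ∈ u.A
      · by_cases h' : (c', i') ≠ (u.a, d)
        · exact (hface u c' c i' i hc' h' hc).symm
        · simp only [ne_eq, not_not, Prod.mk.injEq] at h'
          obtain ⟨rfl, rfl⟩ := h'
          exact (hmiss u c i hne.symm).symm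
      · rw [subst_fill_of_notMem j u hc, subst_fill_of_notMem j u hc',
          subst_fill_of_notMem j (u.subst c i hc) hc', subst_fill_of_notMem j (u.subst c' i' hc') hc,
          hboth]
  | comp d w =>
    classical
    obtain ⟨u, rfl, hu⟩ := w.exists_rep_avoid {c, c'}
    simp only [Finset.mem_insert, Finset.mem_singleton, not_or] at hu
    have hca : c ≠ u.a := Ne.symm hu.1
    have hca' : c' ≠ u.a := Ne.symm hu.2
    have h := OpenBox.ne_of_ne hca i d
    have h' := OpenBox.ne_of_ne hca' i' d
    have hf : ∀ (c c' : 𝔸) (i i' : Bool) (hc : c ∈ u.A) (_ : c ≠ u.a) (_ : c' ∉ u.A)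
        (h : (c, i) ≠ (u.a, d)),
        subst j (subst j (comp d (Comp.mk u)) c i) c' i' =
          subst j (subst j (comp d (Comp.mk u)) c' i') c i := by
      intro c c' i i' hc hca hc' h
      have hca' : c' ≠ u.a := fun e => hc' (e ▸ u.mem)
      rw [subst_comp_face u hj hca hc h, subst_comp_of_notMem u hj hc', ← hs,
        sub_comm _ _ _ _ _ hca'.symm]
      exact (subst_comp_face (u.subst c' i' hc') hj hca hc h).symm
    by_cases hc : c ∈ u.A
    · by_cases hc' : c' ∈ u.A
      · rw [subst_comp_face u hj hca hc h, subst_comp_face u hj hca' hc' h', ← hs, ← hs,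
          sub_comm _ _ _ _ _ hca'.symm, u.adj c i hc h c' i' hc' h' hne,
          sub_comm _ _ _ _ _ hca]
      · exact hf c c' i i' hc hca hc' h
    · by_cases hc' : c' ∈ u.A
      · exact (hf c' c i' i hc' hca' hc h').symm
      · rw [subst_comp_of_notMem u hj hc, subst_comp_of_notMem u hj hc',
          subst_comp_of_notMem (u.subst c i hc) hj hc',
          subst_comp_of_notMem (u.subst c' i' hc') hj hc, hboth]

theorem toRight_subst (hj : ∀ (π : FinPerm 𝔸) z, j (π • z) = π • j z)
    (hr : ∀ z, toRight (j z) = p.toFun z) (s : Step f p) (c : 𝔸) (i : Bool) :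
    toRight (subst j s c i) = sub (toRight s) c i := by
  cases s with
  | base x => exact f.hom.map_sub x c i
  | fill d u =>
    by_cases hc : c ∈ u.A
    · by_cases h : (c, i) ≠ (u.a, d)
      · rw [subst_fill_face j u hc h, hr, u.isOver]
        rfl
      · simp only [ne_eq, not_not, Prod.mk.injEq] at h
        obtain ⟨rfl, rfl⟩ := h
        rw [subst_fill_self, toRight_comp]
        rfl
    · rw [subst_fill_of_notMem j u hc]
      rfl
  | comp d w =>
    obtain ⟨u, rfl, hu⟩ := w.exists_rep_avoid {c}
    have hca : c ≠ u.a := fun e => hu (by simp [e])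
    rw [toRight_comp, sub_comm _ _ _ _ _ hca.symm]
    by_cases hc : c ∈ u.A
    · rw [subst_comp_face u hj hca hc (OpenBox.ne_of_ne hca i d), hr, p.map_sub, u.isOver]
    · rw [subst_comp_of_notMem u hj hc, toRight_comp]
      rfl

end axioms

section map

variable {g : Arrow (Sub01 𝔸)} {Z' : Sub01 𝔸} {p' : Z' ⟶ g.right}

/-- The componentwise map of steps induced by a square `f ⟶ g` and a map of previous stages. -/
noncomputable def map (φ : f ⟶ g) (h : Z ⟶ Z') (w : h ≫ p' = p ≫ φ.right) : Step f p → Step g p'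
  | base x => base (φ.left.toFun x)
  | fill d u => fill d (u.map h φ.right w)
  | comp d v => comp d (Comp.map h φ.right w v)

variable (φ : f ⟶ g) (h : Z ⟶ Z') (w : h ≫ p' = p ≫ φ.right)

theorem map_comp_mk {d : Bool} (u : OpenBox d p) :
    map φ h w (comp d (Comp.mk u)) = comp d (Comp.mk (u.map h φ.right w)) :=
  congrArg (comp d) (Comp.map_mk h φ.right w u)

theorem map_smul (π : FinPerm 𝔸) (s : Step f p) : map φ h w (π • s) = π • map φ h w s := by
  cases s with
  | base x => exact congrArg base (φ.left.map_smul π x)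
  | fill d u => exact congrArg (fill d) (OpenBox.map_smul π u)
  | comp d v => exact congrArg (comp d) (Comp.map_smul h φ.right w π v)

theorem map_subst {j : Z → Step f p} (hj : ∀ (π : FinPerm 𝔸) z, j (π • z) = π • j z)
    {j' : Z' → Step g p'} (hj' : ∀ (π : FinPerm 𝔸) z, j' (π • z) = π • j' z)
    (hjj : ∀ z, map φ h w (j z) = j' (h.toFun z)) (s : Step f p) (c : 𝔸) (i : Bool) :
    map φ h w (subst j s c i) = subst j' (map φ h w s) c i := by
  cases s with
  | base x => exact congrArg base (φ.left.map_sub x c i)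
  | fill d u =>
    by_cases hc : c ∈ u.A
    · by_cases hh : (c, i) ≠ (u.a, d)
      · rw [subst_fill_face j u hc hh, hjj]
        exact (subst_fill_face j' (u.map h φ.right w) hc hh).symm
      · simp only [ne_eq, not_not, Prod.mk.injEq] at hh
        obtain ⟨rfl, rfl⟩ := hh
        rw [subst_fill_self, map_comp_mk]
        exact (subst_fill_self j' (u.map h φ.right w)).symm
    · rw [subst_fill_of_notMem j u hc]
      refine Eq.trans ?_ (subst_fill_of_notMem j' (u.map h φ.right w) hc).symm
      exact congrArg (fill d) (OpenBox.map_subst u c i hc)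
  | comp d v =>
    obtain ⟨u, rfl, hu⟩ := v.exists_rep_avoid {c}
    have hca : c ≠ u.a := fun e => hu (by simp [e])
    rw [map_comp_mk]
    by_cases hc : c ∈ u.A
    · have hh := OpenBox.ne_of_ne hca i d
      rw [subst_comp_face u hj hca hc hh, hjj, h.map_sub]
      exact (subst_comp_face (u.map h φ.right w) hj' hca hc hh).symm
    · rw [subst_comp_of_notMem u hj hc, map_comp_mk, OpenBox.map_subst]
      exact (subst_comp_of_notMem (u.map h φ.right w) hj' hc).symm

theorem toRight_map (s : Step f p) : toRight (map φ h w s) = φ.right.toFun (toRight s) := by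
  cases s with
  | base x => exact Sub01.congr_toFun φ.w x
  | fill d u => rfl
  | comp d v =>
    obtain ⟨u, rfl⟩ := v.exists_rep
    rw [map_comp_mk, toRight_comp, toRight_comp, φ.right.map_sub]
    rfl

theorem map_injective (hl : Function.Injective φ.left.toFun) (hh : Function.Injective h.toFun)
    (hk : Function.Injective φ.right.toFun) : Function.Injective (map φ h w) := by
  intro s t e
  cases s <;> cases t <;> simp only [map, reduceCtorEq] at e
  · exact congrArg base (hl (Step.base.inj e))
  · obtain ⟨rfl, e⟩ := Step.fill.inj e
    exact congrArg (fill _) (OpenBox.map_injective hh hk (eq_of_heq e))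
  · obtain ⟨rfl, e⟩ := Step.comp.inj e
    exact congrArg (comp _) (Comp.map_injective h φ.right w hh hk (eq_of_heq e))

theorem map_id (w') (s : Step f p) : map (𝟙 f) (𝟙 Z) w' s = s := by
  cases s with
  | base x => rfl
  | fill d u => rfl
  | comp d v =>
    obtain ⟨u, rfl⟩ := v.exists_rep
    rw [map_comp_mk]
    rfl

theorem map_map {k : Arrow (Sub01 𝔸)} {Z₂ : Sub01 𝔸} {p₂ : Z₂ ⟶ k.right} (ψ : g ⟶ k)
    (h' : Z' ⟶ Z₂) (w') (w'') (s : Step f p) :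
    map (p' := p₂) ψ h' w' (map φ h w s) = map (φ ≫ ψ) (h ≫ h') w'' s := by
  cases s with
  | base x => rfl
  | fill d u => rfl
  | comp d v =>
    obtain ⟨u, rfl⟩ := v.exists_rep
    rw [map_comp_mk, map_comp_mk, map_comp_mk]
    rfl

end map

end Step

/-! ### The stages -/

/-- Data at a stage: the 01-substitution set `Z` of everything constructed so far, its map to
`Y`, and its inclusion `j` into the next step, compatible with all the structure. -/
structure Stage (f : Arrow (Sub01 𝔸)) : Type (u + 1) where
  Z : Sub01 𝔸
  rho : Z ⟶ f.right
  j : Z → Step f rho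
  j_smul : ∀ (π : FinPerm 𝔸) z, j (π • z) = π • j z
  j_sub : ∀ z (c : 𝔸) i, j (sub z c i) = Step.subst j (j z) c i
  j_rho : ∀ z, Step.toRight (j z) = rho.toFun z
  j_injective : Function.Injective j

namespace Stage

variable {f : Arrow (Sub01 𝔸)}

/-- The 01-substitution set of the next stage. -/
noncomputable def nextZ (S : Stage f) : Sub01 𝔸 where
  carrier := Step f S.rho
  str :=
    { sub := Step.subst S.j
      perm_sub := Step.smul_subst S.j_smul
      fresh_sub := Step.fresh_subst S.j_smul
      sub_of_fresh := Step.subst_of_fresh S.j_smul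
      sub_comm := Step.subst_comm S.j_smul S.j_sub }

noncomputable def nextRho (S : Stage f) : S.nextZ ⟶ f.right where
  toFun := Step.toRight
  map_smul := Step.toRight_smul
  map_sub := Step.toRight_subst S.j_smul S.j_rho

/-- The inclusion of a stage in the next one, as a morphism of 01-substitution sets. -/
noncomputable def incl (S : Stage f) : S.Z ⟶ S.nextZ where
  toFun := S.j
  map_smul := S.j_smul
  map_sub := S.j_sub

theorem incl_rho (S : Stage f) : S.incl ≫ S.nextRho = S.rho :=
  Sub01.hom_ext S.j_rho

/-- The next stage. -/
noncomputable def next (S : Stage f) : Stage f where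
  Z := S.nextZ
  rho := S.nextRho
  j := Step.map (𝟙 f) S.incl (S.incl_rho.trans (Category.comp_id _).symm)
  j_smul := Step.map_smul _ _ _
  j_sub := Step.map_subst _ _ _ S.j_smul (Step.map_smul _ _ _) fun _ => rfl
  j_rho := Step.toRight_map _ _ _
  j_injective := Step.map_injective _ _ _ Function.injective_id S.j_injective
    Function.injective_id

/-- The empty 01-substitution set. -/
def emptySub01 (𝔸 : Type u) : Sub01 𝔸 where
  carrier := PEmpty
  str :=
    { smul := fun _ x => x.elim
      one_smul := fun x => x.elim
      mul_smul := fun _ _ x => x.elim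
      exists_support := fun x => x.elim
      sub := fun x => x.elim
      perm_sub := fun _ x => x.elim
      fresh_sub := fun x => x.elim
      sub_of_fresh := fun x => x.elim
      sub_comm := fun x => x.elim }

variable (f) in
/-- The initial stage, where nothing has been constructed. -/
def empty : Stage f where
  Z := emptySub01 𝔸
  rho := ⟨fun x => x.elim, fun _ x => x.elim, fun x => x.elim⟩
  j := fun x => x.elim
  j_smul := fun _ x => x.elim
  j_sub := fun x => x.elim
  j_rho := fun x => x.elim
  j_injective := fun x => x.elim

end Stage

/-- The stages of the construction. The object of `stage f n` is `colim_{m < n} K_m f`, that is,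
empty for `n = 0` and `K_{n-1} f` otherwise. -/
noncomputable def stage (f : Arrow (Sub01 𝔸)) : ℕ → Stage f
  | 0 => Stage.empty f
  | n + 1 => (stage f n).next

end step

/-! ### Colimits of sequences of 01-substitution sets -/

section seqColim

variable (F : ℕ ⥤ Sub01 𝔸)

/-- The transition map from `n` to `m`. -/
def seqMap {n m : ℕ} (h : n ≤ m) : F.obj n ⟶ F.obj m := F.map (homOfLE h)

theorem seqMap_seqMap {n m k : ℕ} (h : n ≤ m) (h' : m ≤ k) (x : F.obj n) :
    (seqMap F h').toFun ((seqMap F h).toFun x) = (seqMap F (h.trans h')).toFun x :=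
  (Sub01.congr_toFun (F.map_comp (homOfLE h) (homOfLE h')) x).symm

theorem seqMap_self {n : ℕ} (x : F.obj n) : (seqMap F (le_refl n)).toFun x = x :=
  Sub01.congr_toFun (F.map_id n) x

/-- Two elements are identified when they become equal at some later stage. -/
def seqSetoid : Setoid (Σ n, F.obj n) where
  r s t := ∃ (k : ℕ) (hs : s.1 ≤ k) (ht : t.1 ≤ k),
    (seqMap F hs).toFun s.2 = (seqMap F ht).toFun t.2
  iseqv :=
    { refl := fun s => ⟨s.1, le_refl _, le_refl _, rfl⟩
      symm := fun ⟨k, hs, ht, e⟩ => ⟨k, ht, hs, e.symm⟩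
      trans := fun ⟨k, hs, ht, e⟩ ⟨l, ht', hr, e'⟩ => by
        refine ⟨max k l, hs.trans (le_max_left _ _), hr.trans (le_max_right _ _), ?_⟩
        rw [← seqMap_seqMap F hs (le_max_left k l), e, seqMap_seqMap,
          ← seqMap_seqMap F hr (le_max_right k l), ← e', seqMap_seqMap] }

/-- The underlying set of the colimit. -/
def SeqColim : Type u := Quotient (seqSetoid F)

variable {F}

def SeqColim.mk (n : ℕ) (x : F.obj n) : SeqColim F := Quotient.mk (seqSetoid F) ⟨n, x⟩

theorem SeqColim.mk_eq {n m : ℕ} {x : F.obj n} {y : F.obj m} :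
    SeqColim.mk n x = SeqColim.mk m y ↔
      ∃ (k : ℕ) (hn : n ≤ k) (hm : m ≤ k), (seqMap F hn).toFun x = (seqMap F hm).toFun y :=
  Quotient.eq (r := seqSetoid F)

theorem SeqColim.exists_rep (x : SeqColim F) : ∃ n y, SeqColim.mk n y = x := by
  obtain ⟨⟨n, y⟩, rfl⟩ := Quotient.exists_rep x
  exact ⟨n, y, rfl⟩

theorem SeqColim.mk_seqMap {n m : ℕ} (h : n ≤ m) (x : F.obj n) :
    SeqColim.mk m ((seqMap F h).toFun x) = SeqColim.mk n x :=
  SeqColim.mk_eq.2 ⟨m, le_refl _, h, seqMap_self F _⟩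

instance : MulAction (FinPerm 𝔸) (SeqColim F) where
  smul π := Quotient.map (fun s => ⟨s.1, π • s.2⟩) fun s t ⟨k, hs, ht, e⟩ =>
    ⟨k, hs, ht, by rw [(seqMap F hs).map_smul, (seqMap F ht).map_smul, e]⟩
  one_smul x := by
    obtain ⟨n, y, rfl⟩ := x.exists_rep
    exact congrArg (SeqColim.mk n) (one_smul _ y)
  mul_smul π σ x := by
    obtain ⟨n, y, rfl⟩ := x.exists_rep
    exact congrArg (SeqColim.mk n) (mul_smul π σ y)

theorem SeqColim.smul_mk (π : FinPerm 𝔸) (n : ℕ) (x : F.obj n) :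
    π • SeqColim.mk n x = SeqColim.mk n (π • x) := rfl

instance : NominalSet 𝔸 (SeqColim F) where
  exists_support x := by
    obtain ⟨n, y, rfl⟩ := x.exists_rep
    obtain ⟨A, hA⟩ := NominalSet.exists_support (𝔸 := 𝔸) y
    exact ⟨A, fun π hπ => by rw [SeqColim.smul_mk, hA π hπ]⟩

/-- Substitution on the colimit, computed on representatives. -/
def SeqColim.subst (x : SeqColim F) (c : 𝔸) (i : Bool) : SeqColim F :=
  Quotient.map (sa := seqSetoid F) (sb := seqSetoid F) (fun s => ⟨s.1, sub s.2 c i⟩)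
    (fun s t ⟨k, hs, ht, e⟩ => ⟨k, hs, ht, by rw [(seqMap F hs).map_sub, (seqMap F ht).map_sub, e]⟩) x

theorem SeqColim.subst_mk (n : ℕ) (x : F.obj n) (c : 𝔸) (i : Bool) :
    SeqColim.subst (SeqColim.mk n x) c i = SeqColim.mk n (sub x c i) := rfl

variable (F) in
/-- The colimit of a sequence of 01-substitution sets. -/
def seqColim [Infinite 𝔸] : Sub01 𝔸 where
  carrier := SeqColim F
  str :=
    { sub := SeqColim.subst
      perm_sub := fun π x c i => by
        obtain ⟨n, y, rfl⟩ := x.exists_rep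
        exact congrArg (SeqColim.mk n) (perm_sub π y c i)
      fresh_sub := fun x c i => by
        obtain ⟨n, y, rfl⟩ := x.exists_rep
        exact (fresh_sub y c i).map (F := SeqColim.mk n) fun _ _ => rfl
      sub_of_fresh := fun x c i hx => by
        obtain ⟨n, y, rfl⟩ := x.exists_rep
        obtain ⟨e, he, -⟩ := exists_fresh y (∅ : Finset 𝔸)
        have he' : Fresh e (SeqColim.mk n y) := he.map fun _ _ => rfl
        have h1 : swp e c • SeqColim.mk n y = SeqColim.mk n y := swp_smul_of_fresh he' hx
        have h2 : Fresh c (swp e c • y) := by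
          have := he.smul (swp e c)
          rwa [swp_left] at this
        rw [← h1, SeqColim.smul_mk, SeqColim.subst_mk, sub_of_fresh _ _ _ h2]
      sub_comm := fun x c c' i i' hne => by
        obtain ⟨n, y, rfl⟩ := x.exists_rep
        exact congrArg (SeqColim.mk n) (sub_comm y c c' i i' hne) }

variable (F) in
/-- The maps into the colimit. -/
def seqι [Infinite 𝔸] (n : ℕ) : F.obj n ⟶ seqColim F where
  toFun := SeqColim.mk n
  map_smul _ _ := rfl
  map_sub _ _ _ := rfl

variable (F) in
/-- The cocone under the sequence `F` with vertex `seqColim F`. -/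
def seqCocone [Infinite 𝔸] : Limits.Cocone F where
  pt := seqColim F
  ι :=
    { app := seqι F
      naturality := fun n m φ => by
        refine Sub01.hom_ext fun x => ?_
        exact SeqColim.mk_seqMap φ.le x }

theorem compat_of_succ {Z : Sub01 𝔸} (g : ∀ n, F.obj n ⟶ Z)
    (hg : ∀ n x, (g (n + 1)).toFun ((seqMap F n.le_succ).toFun x) = (g n).toFun x) {n m : ℕ}
    (h : n ≤ m) (x : F.obj n) : (g m).toFun ((seqMap F h).toFun x) = (g n).toFun x := by
  induction h with
  | refl => rw [seqMap_self]
  | step h ih => rw [← seqMap_seqMap F h (Nat.le_succ _), hg, ih]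

/-- The map out of the colimit induced by a compatible family. -/
def seqDesc [Infinite 𝔸] {Z : Sub01 𝔸} (g : ∀ n, F.obj n ⟶ Z)
    (hg : ∀ n x, (g (n + 1)).toFun ((seqMap F n.le_succ).toFun x) = (g n).toFun x) :
    seqColim F ⟶ Z where
  toFun := Quotient.lift (fun s : Σ n, F.obj n => (g s.1).toFun s.2) fun s t ⟨k, hs, ht, e⟩ => by
    rw [← compat_of_succ g hg hs s.2, e, compat_of_succ g hg ht t.2]
  map_smul π x := by
    obtain ⟨n, y, rfl⟩ := x.exists_rep
    exact (g n).map_smul π y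
  map_sub x c i := by
    obtain ⟨n, y, rfl⟩ := x.exists_rep
    exact (g n).map_sub y c i

theorem seqDesc_mk [Infinite 𝔸] {Z : Sub01 𝔸} (g : ∀ n, F.obj n ⟶ Z) (hg) (n : ℕ) (x : F.obj n) :
    (seqDesc g hg).toFun ((seqι F n).toFun x) = (g n).toFun x := rfl

end seqColim

/-! ### The functorial factorisation -/

section factorisation

variable [Infinite 𝔸]

/-- The sequence `∅ ⟶ K₀ f ⟶ K₁ f ⟶ ⋯`. -/
noncomputable def stageFunctor (f : Arrow (Sub01 𝔸)) : ℕ ⥤ Sub01 𝔸 :=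
  Functor.ofSequence (X := fun n => (stage f n).Z) fun n => (stage f n).incl

theorem stage_seqMap_succ (f : Arrow (Sub01 𝔸)) (n : ℕ) :
    seqMap (stageFunctor f) n.le_succ = (stage f n).incl :=
  Functor.ofSequence_map_homOfLE_succ (X := fun n => (stage f n).Z) (fun n => (stage f n).incl) n

/-- The object `K f`, the colimit of the stages. -/
noncomputable def kanObj (f : Arrow (Sub01 𝔸)) : Sub01 𝔸 := seqColim (stageFunctor f)

/-- The map of a stage to `K f`. -/
noncomputable def stageι (f : Arrow (Sub01 𝔸)) (n : ℕ) : (stage f n).Z ⟶ kanObj f :=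
  seqι (stageFunctor f) n

theorem stageι_succ (f : Arrow (Sub01 𝔸)) (n : ℕ) (z : (stage f n).Z) :
    (stageι f (n + 1)).toFun ((stage f n).j z) = (stageι f n).toFun z := by
  have h := SeqColim.mk_seqMap (F := stageFunctor f) n.le_succ z
  rw [stage_seqMap_succ] at h
  exact h

theorem exists_stage {f : Arrow (Sub01 𝔸)} (x : kanObj f) :
    ∃ (n : ℕ) (z : (stage f n).Z), (stageι f n).toFun z = x :=
  SeqColim.exists_rep (F := stageFunctor f) x

theorem stageι_injective (f : Arrow (Sub01 𝔸)) (n : ℕ) :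
    Function.Injective (stageι f n).toFun := by
  have key : ∀ {m k : ℕ} (h : m ≤ k), Function.Injective (seqMap (stageFunctor f) h).toFun := by
    intro m k h
    induction h with
    | refl => exact fun x y e => by rwa [seqMap_self, seqMap_self] at e
    | @step k h ih =>
      intro x y e
      rw [← seqMap_seqMap _ h k.le_succ, ← seqMap_seqMap _ h k.le_succ, stage_seqMap_succ] at e
      exact ih ((stage f k).j_injective e)
  intro x y e
  obtain ⟨k, hn, _, e⟩ := (SeqColim.mk_eq (F := stageFunctor f)).1 e
  exact key hn e

/-- The map out of `K f` induced by compatible maps out of the stages. -/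
noncomputable def kanDesc {f : Arrow (Sub01 𝔸)} {Z : Sub01 𝔸} (g : ∀ n, (stage f n).Z ⟶ Z)
    (hg : ∀ n z, (g (n + 1)).toFun ((stage f n).j z) = (g n).toFun z) : kanObj f ⟶ Z :=
  seqDesc (F := stageFunctor f) g fun n x => by
    rw [stage_seqMap_succ]
    exact hg n x

theorem kanDesc_ι {f : Arrow (Sub01 𝔸)} {Z : Sub01 𝔸} (g : ∀ n, (stage f n).Z ⟶ Z) (hg) (n : ℕ)
    (z : (stage f n).Z) : (kanDesc g hg).toFun ((stageι f n).toFun z) = (g n).toFun z := rfl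

/-- The map `λ_f : X ⟶ K f`, the inclusion of `X` in `K₀ f`. -/
noncomputable def kanLambda (f : Arrow (Sub01 𝔸)) : f.left ⟶ kanObj f where
  toFun x := (stageι f 1).toFun (Step.base x)
  map_smul π x := (stageι f 1).map_smul π (Step.base x)
  map_sub x c i := (stageι f 1).map_sub (Step.base x) c i

/-- The map `ρ_f : K f ⟶ Y`. -/
noncomputable def kanRho (f : Arrow (Sub01 𝔸)) : kanObj f ⟶ f.right :=
  kanDesc (fun n => (stage f n).rho) fun n => (stage f n).j_rho

/-- A map of stages over a square `φ : f ⟶ g`, compatible with the inclusions in the next step. -/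
structure StageHom {f g : Arrow (Sub01 𝔸)} (φ : f ⟶ g) (S : Stage f) (T : Stage g) : Type u where
  h : S.Z ⟶ T.Z
  w : h ≫ T.rho = S.rho ≫ φ.right
  compat : ∀ z, Step.map φ h w (S.j z) = T.j (h.toFun z)

namespace StageHom

variable {f g : Arrow (Sub01 𝔸)} {φ : f ⟶ g} {S : Stage f} {T : Stage g}

/-- The componentwise map of the next stages. -/
noncomputable def nextHom (H : StageHom φ S T) : S.nextZ ⟶ T.nextZ where
  toFun := Step.map φ H.h H.w
  map_smul := Step.map_smul φ H.h H.w
  map_sub := Step.map_subst φ H.h H.w S.j_smul T.j_smul H.compat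

theorem incl_nextHom (H : StageHom φ S T) : S.incl ≫ H.nextHom = H.h ≫ T.incl :=
  Sub01.hom_ext H.compat

theorem nextHom_rho (H : StageHom φ S T) : H.nextHom ≫ T.nextRho = S.nextRho ≫ φ.right :=
  Sub01.hom_ext fun s => Step.toRight_map φ H.h H.w s

noncomputable def next (H : StageHom φ S T) : StageHom φ S.next T.next where
  h := H.nextHom
  w := H.nextHom_rho
  compat z := by
    have w1 : (H.h ≫ T.incl) ≫ T.nextRho = S.rho ≫ (𝟙 f ≫ φ).right := by
      rw [Category.assoc, Stage.incl_rho, Category.id_comp, H.w]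
    have w2 : (S.incl ≫ H.nextHom) ≫ T.nextRho = S.rho ≫ (𝟙 f ≫ φ).right := by
      rw [incl_nextHom, w1]
    have w3 : (H.h ≫ T.incl) ≫ T.nextRho = S.rho ≫ (φ ≫ 𝟙 g).right := by
      rw [w1, Category.id_comp, Category.comp_id]
    have e1 : Step.map φ H.nextHom H.nextHom_rho
        (Step.map (𝟙 f) S.incl (S.incl_rho.trans (Category.comp_id _).symm) z) =
        Step.map (𝟙 f ≫ φ) (S.incl ≫ H.nextHom) w2 z := Step.map_map _ _ _ _ _ _ _ z
    have e2 : Step.map (𝟙 g) T.incl (T.incl_rho.trans (Category.comp_id _).symm)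
        (Step.map φ H.h H.w z) = Step.map (φ ≫ 𝟙 g) (H.h ≫ T.incl) w3 z :=
      Step.map_map _ _ _ _ _ _ _ z
    refine e1.trans (Eq.trans ?_ e2.symm)
    congr 1
    exact H.incl_nextHom

theorem next_id {S : Stage f} (H : StageHom (𝟙 f) S S) (e : H.h = 𝟙 _) : H.next.h = 𝟙 _ := by
  obtain ⟨h, w, c⟩ := H
  dsimp only at e
  subst e
  exact Sub01.hom_ext fun s => Step.map_id w s

theorem next_comp {k : Arrow (Sub01 𝔸)} {ψ : g ⟶ k} {U : Stage k} (H : StageHom φ S T)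
    (H' : StageHom ψ T U) (G : StageHom (φ ≫ ψ) S U) (e : G.h = H.h ≫ H'.h) :
    G.next.h = H.next.h ≫ H'.next.h := by
  obtain ⟨h, w, c⟩ := G
  dsimp only at e
  subst e
  exact Sub01.hom_ext fun s => (Step.map_map φ H.h H.w ψ H'.h H'.w w s).symm

end StageHom

/-- The maps of stages induced by a square `φ : f ⟶ g`. -/
noncomputable def stageMap {f g : Arrow (Sub01 𝔸)} (φ : f ⟶ g) :
    ∀ n : ℕ, StageHom φ (stage f n) (stage g n)
  | 0 =>
    { h := 𝟙 (Stage.emptySub01 𝔸)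
      w := Sub01.hom_ext fun x => x.elim
      compat := fun x => x.elim }
  | n + 1 => (stageMap φ n).next

theorem stageMap_succ {f g : Arrow (Sub01 𝔸)} (φ : f ⟶ g) (n : ℕ) (z : (stage f n).Z) :
    (stageMap φ (n + 1)).h.toFun ((stage f n).j z) = (stage g n).j ((stageMap φ n).h.toFun z) :=
  (stageMap φ n).compat z

/-- The action of `K` on squares. -/
noncomputable def kanMap {f g : Arrow (Sub01 𝔸)} (φ : f ⟶ g) : kanObj f ⟶ kanObj g :=
  kanDesc (fun n => (stageMap φ n).h ≫ stageι g n) fun n z =>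
    (congrArg (stageι g (n + 1)).toFun (stageMap_succ φ n z)).trans (stageι_succ g n _)

theorem stageMap_id (f : Arrow (Sub01 𝔸)) (n : ℕ) : (stageMap (𝟙 f) n).h = 𝟙 _ := by
  induction n with
  | zero => rfl
  | succ n ih => exact StageHom.next_id _ ih

theorem stageMap_comp {f g k : Arrow (Sub01 𝔸)} (φ : f ⟶ g) (ψ : g ⟶ k) (n : ℕ) :
    (stageMap (φ ≫ ψ) n).h = (stageMap φ n).h ≫ (stageMap ψ n).h := by
  induction n with
  | zero => rfl
  | succ n ih => exact StageHom.next_comp _ _ _ ih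

/-- The functor `K`. -/
noncomputable def kanFunctor (𝔸 : Type u) [Infinite 𝔸] : Arrow (Sub01 𝔸) ⥤ Sub01 𝔸 where
  obj := kanObj
  map := kanMap
  map_id f := Sub01.hom_ext fun x => by
    obtain ⟨n, z, rfl⟩ := exists_stage x
    exact congrArg (stageι f n).toFun (Sub01.congr_toFun (stageMap_id f n) z)
  map_comp {f g k} φ ψ := Sub01.hom_ext fun x => by
    obtain ⟨n, z, rfl⟩ := exists_stage x
    exact congrArg (stageι k n).toFun (Sub01.congr_toFun (stageMap_comp φ ψ n) z)

/-- A functorial factorisation on `C`: a functor `K : Arrow C ⥤ C` (called `Z` here) and natural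
maps `λ_f : X ⟶ K f` and `ρ_f : K f ⟶ Y` (called `i` and `p`) with `λ_f ≫ ρ_f = f`. -/
abbrev FunctorialFactorisation (C : Type*) [Category C] :=
  MorphismProperty.FunctorialFactorizationData (⊤ : MorphismProperty C) ⊤

/-- The functorial factorisation `K, λ, ρ` on 01-substitution sets. -/
noncomputable def kanFactorisation (𝔸 : Type u) [Infinite 𝔸] :
    FunctorialFactorisation (Sub01 𝔸) where
  Z := kanFunctor 𝔸
  i := { app := kanLambda, naturality := fun _ _ _ => rfl }
  p :=
    { app := kanRho
      naturality := fun f g φ => Sub01.hom_ext fun x => by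
        obtain ⟨n, z, rfl⟩ := exists_stage x
        exact Sub01.congr_toFun (stageMap φ n).w z }
  fac := by
    ext f
    rfl
  hi _ := trivial
  hp _ := trivial

/-! ### Free fillers in `K f` -/

/-- Every open box in `K f` comes from an open box at some stage. -/
theorem exists_stage_box {f : Arrow (Sub01 𝔸)} {d : Bool} (u : OpenBox d (kanRho f)) :
    ∃ (n : ℕ) (v : OpenBox d (stage f n).rho), v.map (p' := kanRho f) (stageι f n) (𝟙 _) rfl = u := by
  classical
  have h1 : ∀ x : kanObj f, ∃ n, ∀ m, n ≤ m → ∃ z, (stageι f m).toFun z = x := by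
    intro x
    obtain ⟨n, z, rfl⟩ := exists_stage x
    refine ⟨n, fun m hm => ?_⟩
    induction hm with
    | refl => exact ⟨z, rfl⟩
    | @step m _ ih =>
      obtain ⟨z', hz'⟩ := ih
      exact ⟨(stage f m).j z', (stageι_succ f m z').trans hz'⟩
  choose N hN using h1
  let M : 𝔸 → Bool → ℕ := fun b i => if h : ∃ (hb : b ∈ u.A), (b, i) ≠ (u.a, d) then
    N (u.face b i h.1 h.2) else 0
  let T := u.A.sup fun b => max (M b false) (M b true)
  have h2 : ∀ b i hb h, N (u.face b i hb h) ≤ T := by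
    intro b i hb h
    have e : M b i = N (u.face b i hb h) := dif_pos ⟨hb, h⟩
    rw [← e]
    refine le_trans ?_ (Finset.le_sup (f := fun b => max (M b false) (M b true)) hb)
    cases i
    · exact le_max_left _ _
    · exact le_max_right _ _
  have h3 : ∀ b i hb h, ∃ z, (stageι f T).toFun z = u.face b i hb h :=
    fun b i hb h => hN _ _ (h2 b i hb h)
  choose face hface using h3
  refine ⟨T, ⟨u.A, u.a, u.mem, u.y, face, ?_, ?_, ?_⟩, ?_⟩
  · intro b i hb h
    have := u.fresh b i hb h
    rw [← hface] at this
    exact this.of_map (stageι f T).map_smul (stageι_injective f T)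
  · intro b i hb h b' i' hb' h' hne
    apply stageι_injective f T
    rw [(stageι f T).map_sub, (stageι f T).map_sub, hface, hface]
    exact u.adj b i hb h b' i' hb' h' hne
  · intro b i hb h
    rw [← u.isOver b i hb h, ← hface]
    rfl
  · exact OpenBox.ext' rfl rfl rfl fun b i hb h _ _ => hface b i hb h

/-- The element of `K f` that was freely added as the filler of an open box `(u, y)` in `K f`:
it is the image of the element `(u, y)` of the next stage. -/
noncomputable def freeFill {f : Arrow (Sub01 𝔸)} {d : Bool} (u : OpenBox d (kanRho f)) : kanObj f :=
  (stageι f ((exists_stage_box u).choose + 1)).toFun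
    (Step.fill d (exists_stage_box u).choose_spec.choose)

/-- The free filler does not depend on the stage at which the box is considered. -/
theorem freeFill_map {f : Arrow (Sub01 𝔸)} {d : Bool} {n : ℕ} (v : OpenBox d (stage f n).rho) :
    freeFill (v.map (p' := kanRho f) (stageι f n) (𝟙 _) rfl) = (stageι f (n + 1)).toFun (Step.fill d v) := by
  -- moving a box to a later stage
  have h1 : ∀ {n : ℕ} (v : OpenBox d (stage f n).rho) {m : ℕ}, n ≤ m →
      ∃ v' : OpenBox d (stage f m).rho,
        v'.map (p' := kanRho f) (stageι f m) (𝟙 _) rfl = v.map (p' := kanRho f) (stageι f n) (𝟙 _) rfl ∧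
        (stageι f (m + 1)).toFun (Step.fill d v') = (stageι f (n + 1)).toFun (Step.fill d v) := by
    intro n v m hm
    induction hm with
    | refl => exact ⟨v, rfl, rfl⟩
    | @step m _ ih =>
      obtain ⟨v', e1, e2⟩ := ih
      refine ⟨v'.map (stage f m).incl (𝟙 _) (Stage.incl_rho _), ?_, ?_⟩
      · rw [← e1]
        exact OpenBox.ext' rfl rfl rfl fun b i hb h _ _ => stageι_succ f m _
      · rw [← e2]
        exact stageι_succ f (m + 1) (Step.fill d v')
  have hu := (exists_stage_box (v.map (p' := kanRho f) (stageι f n) (𝟙 _) rfl)).choose_spec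
  obtain ⟨v₁, a1, a2⟩ := h1 v (le_max_right (exists_stage_box
    (v.map (p' := kanRho f) (stageι f n) (𝟙 _) rfl)).choose n)
  obtain ⟨v₂, b1, b2⟩ := h1 hu.choose (le_max_left (exists_stage_box
    (v.map (p' := kanRho f) (stageι f n) (𝟙 _) rfl)).choose n)
  refine b2.symm.trans (Eq.trans ?_ a2)
  congr 2
  exact OpenBox.map_injective (stageι_injective f _) Function.injective_id
    (b1.trans (hu.choose_spec.trans a1.symm))

end factorisation

/-! ### Algebraic weak factorisation systems -/

section awfs

universe v w

variable {C : Type w} [Category.{v} C]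

namespace FunctorialFactorisation

variable (F : FunctorialFactorisation C)

/-- The endofunctor `L : f ↦ λ_f`. -/
def L : Arrow C ⥤ Arrow C where
  obj f := Arrow.mk (F.i.app f)
  map φ := Arrow.homMk φ.left (F.Z.map φ) (F.i.naturality φ)
  map_id f := Arrow.hom_ext _ _ rfl (F.Z.map_id f)
  map_comp φ ψ := Arrow.hom_ext _ _ rfl (F.Z.map_comp φ ψ)

/-- The copointing `L ⟶ 𝟭`, with components `(𝟙, ρ_f)`. -/
def counit : L F ⟶ 𝟭 (Arrow C) where
  app f := Arrow.homMk (𝟙 f.left) (F.p.app f) ((Category.id_comp _).trans F.fac_app.symm)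
  naturality _ _ φ := Arrow.hom_ext _ _
    ((Category.comp_id _).trans (Category.id_comp _).symm) (F.p.naturality φ)

/-- The endofunctor `R : f ↦ ρ_f`. -/
def R : Arrow C ⥤ Arrow C where
  obj f := Arrow.mk (F.p.app f)
  map φ := Arrow.homMk (F.Z.map φ) φ.right (F.p.naturality φ)
  map_id f := Arrow.hom_ext _ _ (F.Z.map_id f) rfl
  map_comp φ ψ := Arrow.hom_ext _ _ (F.Z.map_comp φ ψ) rfl

/-- The pointing `𝟭 ⟶ R`, with components `(λ_f, 𝟙)`. -/
def unit : 𝟭 (Arrow C) ⟶ R F where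
  app f := Arrow.homMk (F.i.app f) (𝟙 f.right) (F.fac_app.trans (Category.comp_id _).symm)
  naturality _ _ φ := Arrow.hom_ext _ _ (F.i.naturality φ)
    ((Category.comp_id _).trans (Category.id_comp _).symm)

end FunctorialFactorisation

open FunctorialFactorisation

/-- The structure of an algebraic weak factorisation system on a functorial factorisation:
`Σ : L ⟶ L²` making `L` a comonad and `Π : R² ⟶ R` making `R` a monad. -/
structure AWFSStructure (F : FunctorialFactorisation C) where
  comult : L F ⟶ L F ⋙ L F
  mult : R F ⋙ R F ⟶ R F
  comult_coassoc : ∀ f, comult.app f ≫ (L F).map (comult.app f) =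
    comult.app f ≫ comult.app ((L F).obj f)
  comult_left_counit : ∀ f, comult.app f ≫ (counit F).app ((L F).obj f) = 𝟙 _
  comult_right_counit : ∀ f, comult.app f ≫ (L F).map ((counit F).app f) = 𝟙 _
  mult_assoc : ∀ f, (R F).map (mult.app f) ≫ mult.app f =
    mult.app ((R F).obj f) ≫ mult.app f
  mult_left_unit : ∀ f, (unit F).app ((R F).obj f) ≫ mult.app f = 𝟙 _
  mult_right_unit : ∀ f, (R F).map ((unit F).app f) ≫ mult.app f = 𝟙 _

namespace AWFSStructure

variable {F : FunctorialFactorisation C} (W : AWFSStructure F)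

/-- The comonad `𝖫`. -/
def comonad : Comonad (Arrow C) where
  toFunctor := L F
  ε := counit F
  δ := W.comult
  coassoc := W.comult_coassoc
  left_counit := W.comult_left_counit
  right_counit := W.comult_right_counit

/-- The monad `𝖱`. -/
def monad : Monad (Arrow C) where
  toFunctor := R F
  η := unit F
  μ := W.mult
  assoc := W.mult_assoc
  left_unit := W.mult_left_unit
  right_unit := W.mult_right_unit

end AWFSStructure

/-- An algebra structure on the object `X` over the monad `T`. -/
@[ext]
structure AlgebraStructure (T : Monad C) (X : C) where
  a : T.obj X ⟶ X
  unit : T.η.app X ≫ a = 𝟙 X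
  assoc : T.μ.app X ≫ a = T.map a ≫ a

end awfs

end KanAWFS

open KanAWFS

/-!
The reason behind all three parts is that `K f` carries the free pair of Kan filling operators on
`f`. Free fillers are uniform Kan filling operators for `ρ_f` (`freeFilling`), and given a square
from `f` to a map `g` equipped with Kan filling operators, there is exactly one map from `K f` to
the domain of `g` that extends the square and sends free fillers to chosen fillers. Existence
(`kanLift`) is by recursion on the stages: an added composition `⟨a⟩(u, y)` has to go to the missing
face of the filler chosen for `(u, y)`, and uniformity of the operators makes this a morphism.
Uniqueness (`kanObj_hom_ext`) holds because every element of `K f` is in the image of `λ_f`, a free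
filler, or the missing face of a free filler (`kanObj_induction`).

Lifting the identity square of `ρ_f` along the free fillers gives the multiplication `π_f`. For the
comultiplication, Kan filling operators compose (`KanFilling.comp`), so that the composite
`K λ_f ⟶ K f ⟶ Y` has Kan filling operators, and `σ_f` is the lift of the square given by
`λ_{λ_f}`. All the laws of the algebraic weak factorisation system equate maps out of `K f`, and
follow from uniqueness.

An algebra structure on `f` gives filling operators by applying the algebra map to free fillers;
conversely, Kan filling operators for `f` give an algebra map by lifting the identity square of `f`.
That the algebra map can be recovered (`AlgebraStructure.left_freeFill`) is the associativity law.
-/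

namespace KanAWFS

open SubstSet

section kan

variable {𝔸 : Type u} [Infinite 𝔸]

/-! ### Colimits of sequences -/

theorem nonempty_isColimit_seqCocone (F : ℕ ⥤ Sub01 𝔸) :
    Nonempty (Limits.IsColimit (seqCocone F)) :=
  ⟨{ desc := fun s => seqDesc (fun n => s.ι.app n) fun n x =>
        Sub01.congr_toFun (s.w (homOfLE n.le_succ)) x
     fac := fun _ _ => rfl
     uniq := fun _ _ hm => Sub01.hom_ext fun x => by
        obtain ⟨n, y, rfl⟩ := SeqColim.exists_rep x
        exact Sub01.congr_toFun (hm n) y }⟩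

/-! ### Free fillers form a Kan filling operator -/

section freeFill

variable {f : Arrow (Sub01 𝔸)} {d : Bool}

theorem sub_freeFill_face (u : OpenBox d (kanRho f)) {b : 𝔸} {i : Bool} (hb : b ∈ u.A)
    (h : (b, i) ≠ (u.a, d)) : sub (freeFill u) b i = u.face b i hb h := by
  obtain ⟨n, v, rfl⟩ := exists_stage_box u
  rw [freeFill_map]
  exact ((stageι f (n + 1)).map_sub (Step.fill d v) b i).symm.trans
    ((congrArg _ (Step.subst_fill_face _ v hb h)).trans (stageι_succ f n _))

theorem kanRho_freeFill (u : OpenBox d (kanRho f)) : (kanRho f).toFun (freeFill u) = u.y := by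
  obtain ⟨n, v, rfl⟩ := exists_stage_box u
  rw [freeFill_map]
  rfl

theorem freeFill_smul (π : FinPerm 𝔸) (u : OpenBox d (kanRho f)) :
    freeFill (π • u) = π • freeFill u := by
  obtain ⟨n, v, rfl⟩ := exists_stage_box u
  rw [freeFill_map]
  exact (congrArg freeFill (OpenBox.map_smul π v)).symm.trans (freeFill_map (π • v))

theorem freeFill_subst (u : OpenBox d (kanRho f)) (c : 𝔸) (i : Bool) (hc : c ∉ u.A) :
    freeFill (u.subst c i hc) = sub (freeFill u) c i := by
  obtain ⟨n, v, rfl⟩ := exists_stage_box u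
  rw [freeFill_map]
  refine (congrArg freeFill (OpenBox.map_subst v c i hc)).symm.trans ?_
  refine (freeFill_map (v.subst c i hc)).trans ?_
  exact (congrArg _ (Step.subst_fill_of_notMem _ v hc).symm).trans
    ((stageι f (n + 1)).map_sub (Step.fill d v) c i)

variable (f) in
/-- The free fillers in `K f`, as a uniform Kan filling operator for `ρ_f`. -/
noncomputable def freeFilling (d : Bool) : KanFilling d (kanRho f) where
  fill := freeFill
  isFiller u := ⟨fun _ _ hb h => sub_freeFill_face u hb h, kanRho_freeFill u⟩
  fill_smul := freeFill_smul
  fill_subst := freeFill_subst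

theorem stageι_base (n : ℕ) (x : f.left) :
    (stageι f (n + 1)).toFun (Step.base x) = (kanLambda f).toFun x := by
  induction n with
  | zero => rfl
  | succ n ih => exact (stageι_succ f (n + 1) (Step.base x)).trans ih

/-- A freely added Kan composition is the missing face of a free filler. -/
theorem stageι_comp (n : ℕ) (v : OpenBox d (stage f n).rho) :
    (stageι f (n + 1)).toFun (Step.comp d (Comp.mk v)) =
      sub (freeFill (v.map (p' := kanRho f) (stageι f n) (𝟙 _) rfl)) v.a d := by
  rw [freeFill_map]
  exact (congrArg _ (Step.subst_fill_self _ v).symm).trans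
    ((stageι f (n + 1)).map_sub (Step.fill d v) v.a d)

/-- `K f` is generated by `X` under free fillers and their missing faces. -/
theorem kanObj_induction {P : kanObj f → Prop} (base : ∀ x, P ((kanLambda f).toFun x))
    (fill : ∀ d (u : OpenBox d (kanRho f)), (∀ b i hb h, P (u.face b i hb h)) → P (freeFill u))
    (comp : ∀ d (u : OpenBox d (kanRho f)), P (freeFill u) → P (sub (freeFill u) u.a d))
    (x : kanObj f) : P x := by
  obtain ⟨n, z, rfl⟩ := exists_stage x
  induction n with
  | zero => exact z.elim
  | succ n ih =>
    have hfill : ∀ d (v : OpenBox d (stage f n).rho),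
        P (freeFill (v.map (p' := kanRho f) (stageι f n) (𝟙 _) rfl)) :=
      fun d v => fill d _ fun _ _ _ _ => ih _
    cases z with
    | base x =>
      rw [stageι_base]
      exact base x
    | fill d v =>
      rw [← freeFill_map]
      exact hfill d v
    | comp d w =>
      obtain ⟨v, rfl⟩ := w.exists_rep
      rw [stageι_comp]
      exact comp d _ (hfill d v)

theorem kanObj_hom_ext {Z : Sub01 𝔸} {g g' : kanObj f ⟶ Z}
    (base : ∀ x, g.toFun ((kanLambda f).toFun x) = g'.toFun ((kanLambda f).toFun x))
    (fill : ∀ d (u : OpenBox d (kanRho f)),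
      (∀ b i hb h, g.toFun (u.face b i hb h) = g'.toFun (u.face b i hb h)) →
        g.toFun (freeFill u) = g'.toFun (freeFill u)) : g = g' :=
  Sub01.hom_ext <| kanObj_induction base fill fun d u e => by rw [g.map_sub, g'.map_sub, e]

theorem kanMap_rho {g : Arrow (Sub01 𝔸)} (φ : f ⟶ g) :
    kanMap φ ≫ kanRho g = kanRho f ≫ φ.right :=
  (kanFactorisation 𝔸).p.naturality φ

theorem kanMap_freeFill {g : Arrow (Sub01 𝔸)} (φ : f ⟶ g) (u : OpenBox d (kanRho f)) :
    (kanMap φ).toFun (freeFill u) = freeFill (u.map (kanMap φ) φ.right (kanMap_rho φ)) := by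
  obtain ⟨n, v, rfl⟩ := exists_stage_box u
  rw [freeFill_map]
  exact (freeFill_map (v.map (stageMap φ n).h φ.right (stageMap φ n).w)).symm

end freeFill

/-! ### The universal property of `K f` -/

section lift

variable {f g : Arrow (Sub01 𝔸)} (F : ∀ d, KanFilling d g.hom) (φ : f ⟶ g)

section step

variable {V : Sub01 𝔸} {q : V ⟶ f.right} (h : V ⟶ g.left) (w : h ≫ g.hom = q ≫ φ.right)

/-- The map out of one step of the construction which sends an added filler to the filler
chosen by `F`, and an added composition to the missing face of that filler. -/
noncomputable def Step.lift : Step f q → g.left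
  | base x => φ.left.toFun x
  | fill d u => (F d).fill (u.map h φ.right w)
  | comp d v => Comp.elim (fun u => sub ((F d).fill (u.map h φ.right w)) u.a d) ∅ v

theorem Step.lift_comp {d : Bool} (u : OpenBox d q) :
    Step.lift F φ h w (comp d (Comp.mk u)) = sub ((F d).fill (u.map h φ.right w)) u.a d := by
  refine Comp.elim_mk (fun u : OpenBox d q => sub ((F d).fill (u.map h φ.right w)) u.a d) ∅
    ?_ (fun _ _ => fresh_sub _ _ _) u (by simp)
  intro π _ u _
  rw [OpenBox.map_smul, (F d).fill_smul, perm_sub]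
  rfl

theorem Step.lift_smul (π : FinPerm 𝔸) (s : Step f q) :
    Step.lift F φ h w (π • s) = π • Step.lift F φ h w s := by
  cases s with
  | base x => exact φ.left.map_smul π x
  | fill d u => exact (congrArg _ (OpenBox.map_smul π u)).trans ((F d).fill_smul π _)
  | comp d v =>
    obtain ⟨u, rfl⟩ := v.exists_rep
    rw [Step.smul_comp, Comp.smul_mk, Step.lift_comp, Step.lift_comp, OpenBox.map_smul,
      (F d).fill_smul, perm_sub]
    rfl

theorem Step.lift_subst {j : V → Step f q} (hj : ∀ (π : FinPerm 𝔸) z, j (π • z) = π • j z)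
    (hl : ∀ z, Step.lift F φ h w (j z) = h.toFun z) (s : Step f q) (c : 𝔸) (i : Bool) :
    Step.lift F φ h w (Step.subst j s c i) = sub (Step.lift F φ h w s) c i := by
  cases s with
  | base x => exact φ.left.map_sub x c i
  | fill d u =>
    by_cases hc : c ∈ u.A
    · by_cases hh : (c, i) ≠ (u.a, d)
      · rw [Step.subst_fill_face j u hc hh, hl]
        exact (((F d).isFiller (u.map h φ.right w)).face c i hc hh).symm
      · simp only [ne_eq, not_not, Prod.mk.injEq] at hh
        obtain ⟨rfl, rfl⟩ := hh
        rw [Step.subst_fill_self, Step.lift_comp]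
        rfl
    · rw [Step.subst_fill_of_notMem j u hc]
      exact (congrArg _ (OpenBox.map_subst u c i hc)).trans ((F d).fill_subst _ c i hc)
  | comp d v =>
    obtain ⟨u, rfl, hu⟩ := v.exists_rep_avoid {c}
    have hca : c ≠ u.a := fun e => hu (by simp [e])
    -- as `c ≠ u.a`, the substitution at `c` may be carried out on the chosen filler itself
    rw [Step.lift_comp, sub_comm _ _ _ _ _ hca.symm]
    by_cases hc : c ∈ u.A
    · have hh := OpenBox.ne_of_ne hca i d
      rw [Step.subst_comp_face u hj hca hc hh, hl, h.map_sub]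
      exact congrArg (sub · u.a d)
        (((F d).isFiller (u.map h φ.right w)).face c i hc hh).symm
    · rw [Step.subst_comp_of_notMem u hj hc, Step.lift_comp, OpenBox.map_subst,
        (F d).fill_subst _ c i hc]
      rfl

theorem Step.hom_lift (s : Step f q) :
    g.hom.toFun (Step.lift F φ h w s) = φ.right.toFun (Step.toRight s) := by
  cases s with
  | base x => exact Sub01.congr_toFun φ.w x
  | fill d u => exact ((F d).isFiller _).isOver
  | comp d v =>
    obtain ⟨u, rfl⟩ := v.exists_rep
    rw [Step.lift_comp, Step.toRight_comp, g.hom.map_sub, ((F d).isFiller _).isOver,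
      φ.right.map_sub]
    rfl

theorem Step.lift_map {V' : Sub01 𝔸} {q' : V' ⟶ f.right} (e : V' ⟶ V) (we) (w')
    (s : Step f q') : Step.lift F φ h w (Step.map (𝟙 f) e we s) =
      Step.lift F φ (e ≫ h) w' s := by
  cases s with
  | base x => rfl
  | fill d u => rfl
  | comp d v =>
    obtain ⟨u, rfl⟩ := v.exists_rep
    rw [Step.map_comp_mk, Step.lift_comp, Step.lift_comp]
    rfl

end step

/-- A map from a stage to the domain of `g`, over the square `φ`, which sends added fillers to the
fillers chosen by `F`. -/
structure StageLift (S : Stage f) : Type u where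
  h : S.Z ⟶ g.left
  w : h ≫ g.hom = S.rho ≫ φ.right
  compat : ∀ z, Step.lift F φ h w (S.j z) = h.toFun z

variable {F φ}

/-- The extension of a map from a stage to the next stage. -/
noncomputable def StageLift.next {S : Stage f} (H : StageLift F φ S) : StageLift F φ S.next where
  h :=
    { toFun := Step.lift F φ H.h H.w
      map_smul := Step.lift_smul F φ H.h H.w
      map_sub := Step.lift_subst F φ H.h H.w S.j_smul H.compat }
  w := Sub01.hom_ext fun s => Step.hom_lift F φ H.h H.w s
  compat z := by
    refine (Step.lift_map F φ _ _ S.incl _ ?_ z).trans ?_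
    · exact Sub01.hom_ext fun z => (Step.hom_lift F φ H.h H.w (S.j z)).trans
        (congrArg _ (S.j_rho z))
    · congr 1
      exact Sub01.hom_ext H.compat

variable (F φ)

/-- The maps from the stages determined by the square `φ` and the filling operators `F`. -/
noncomputable def stageLift : ∀ n : ℕ, StageLift F φ (stage f n)
  | 0 =>
    { h := ⟨fun x => x.elim, fun _ x => x.elim, fun x => x.elim⟩
      w := Sub01.hom_ext fun x => x.elim
      compat := fun x => x.elim }
  | n + 1 => (stageLift n).next

/-- The map from `K f` to the domain of `g` induced by a square `φ : f ⟶ g` and Kan filling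
operators `F` for `g`: the unique one that extends `φ` and sends free fillers to the fillers chosen
by `F`. -/
noncomputable def kanLift : kanObj f ⟶ g.left :=
  kanDesc (fun n => (stageLift F φ n).h) fun n z => (stageLift F φ n).compat z

theorem kanLift_hom : kanLift F φ ≫ g.hom = kanRho f ≫ φ.right :=
  Sub01.hom_ext fun x => by
    obtain ⟨n, z, rfl⟩ := exists_stage x
    exact Sub01.congr_toFun (stageLift F φ n).w z

theorem kanLift_freeFill {d : Bool} (u : OpenBox d (kanRho f)) :
    (kanLift F φ).toFun (freeFill u) =
      (F d).fill (u.map (kanLift F φ) φ.right (kanLift_hom F φ)) := by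
  obtain ⟨n, v, rfl⟩ := exists_stage_box u
  rw [freeFill_map]
  rfl

end lift

/-! ### Composition of Kan filling operators -/

section comp

variable {d : Bool} {X Y Z : Sub01 𝔸} {p : X ⟶ Y} {q : Y ⟶ Z}

/-- An open box over `p ≫ q` together with a filler `y` of its image under `p` is an open box
over `p`. -/
def OpenBox.withFiller (u : OpenBox d (p ≫ q)) (y : Y)
    (hy : IsFiller (u.map (p' := q) p (𝟙 Z) rfl) y) : OpenBox d p where
  A := u.A
  a := u.a
  mem := u.mem
  y := y
  face := u.face
  fresh := u.fresh
  adj := u.adj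
  isOver b i hb h := (hy.face b i hb h).symm

/-- Filling operators for `p` and `q` compose to one for `p ≫ q`: fill the image of the box over
`q`, then fill the box over the filler found. -/
def KanFilling.comp (P : KanFilling d p) (Q : KanFilling d q) : KanFilling d (p ≫ q) where
  fill u := P.fill (u.withFiller _ (Q.isFiller _))
  isFiller u := ⟨(P.isFiller (u.withFiller _ (Q.isFiller _))).face,
    (congrArg q.toFun (P.isFiller (u.withFiller _ (Q.isFiller _))).isOver).trans
      (Q.isFiller (u.map p (𝟙 Z) rfl)).isOver⟩
  fill_smul π u := by
    rw [← P.fill_smul]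
    refine congrArg P.fill (OpenBox.ext' rfl rfl ?_ fun _ _ _ _ _ _ => rfl)
    exact (congrArg Q.fill (OpenBox.map_smul π u)).trans (Q.fill_smul π _)
  fill_subst u c i hc := by
    rw [← P.fill_subst (u.withFiller _ (Q.isFiller _)) c i hc]
    refine congrArg P.fill (OpenBox.ext' rfl rfl ?_ fun _ _ _ _ _ _ => rfl)
    exact (congrArg Q.fill (OpenBox.map_subst u c i hc)).trans (Q.fill_subst _ c i hc)

end comp

/-! ### The multiplication and the comultiplication -/

section awfs

/-- The map `π_f : K ρ_f ⟶ K f`. -/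
noncomputable def kanPi (f : Arrow (Sub01 𝔸)) : kanObj (Arrow.mk (kanRho f)) ⟶ kanObj f :=
  kanLift (g := Arrow.mk (kanRho f)) (freeFilling f) (𝟙 _)

theorem kanPi_rho (f : Arrow (Sub01 𝔸)) :
    kanPi f ≫ kanRho f = kanRho (Arrow.mk (kanRho f)) ≫ 𝟙 f.right :=
  kanLift_hom (g := Arrow.mk (kanRho f)) (freeFilling f) (𝟙 _)

theorem kanPi_freeFill (f : Arrow (Sub01 𝔸)) {d : Bool}
    (u : OpenBox d (kanRho (Arrow.mk (kanRho f)))) :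
    (kanPi f).toFun (freeFill u) = freeFill (u.map (kanPi f) (𝟙 f.right) (kanPi_rho f)) :=
  kanLift_freeFill (g := Arrow.mk (kanRho f)) (freeFilling f) (𝟙 _) u

/-- The square from `f` to `ρ_{λ_f} ≫ ρ_f` along which `σ_f` is induced. -/
noncomputable def kanSigmaSquare (f : Arrow (Sub01 𝔸)) :
    f ⟶ Arrow.mk (kanRho (Arrow.mk (kanLambda f)) ≫ kanRho f) :=
  Arrow.homMk (kanLambda (Arrow.mk (kanLambda f))) (𝟙 f.right) rfl

/-- The map `σ_f : K f ⟶ K λ_f`, induced by the composite of the free filling operators for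
`ρ_{λ_f}` and `ρ_f`. -/
noncomputable def kanSigma (f : Arrow (Sub01 𝔸)) : kanObj f ⟶ kanObj (Arrow.mk (kanLambda f)) :=
  kanLift (fun d => (freeFilling (Arrow.mk (kanLambda f)) d).comp (freeFilling f d))
    (kanSigmaSquare f)

/-- `ρ_{λ_f} ∘ σ_f` extends `λ_f` and preserves free fillers, hence is the identity. -/
theorem kanSigma_rho (f : Arrow (Sub01 𝔸)) :
    kanSigma f ≫ kanRho (Arrow.mk (kanLambda f)) = 𝟙 (kanObj f) := by
  refine kanObj_hom_ext (fun x => rfl) fun d u hu => ?_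
  rw [Sub01.comp_apply, Sub01.id_apply, show (kanSigma f).toFun (freeFill u) = _ from
    kanLift_freeFill _ (kanSigmaSquare f) u]
  refine (kanRho_freeFill _).trans (congrArg freeFill ?_)
  exact OpenBox.ext' rfl rfl rfl fun b i hb h _ _ => hu b i hb h

theorem rho_kanSigma (f : Arrow (Sub01 𝔸)) (x : kanObj f) :
    (kanRho (Arrow.mk (kanLambda f))).toFun ((kanSigma f).toFun x) = x :=
  Sub01.congr_toFun (kanSigma_rho f) x

/-- The open box `(σ_f ∘ u, (u, y))` over `ρ_{λ_f}`. -/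
noncomputable def sigmaBox {f : Arrow (Sub01 𝔸)} {d : Bool} (u : OpenBox d (kanRho f)) :
    OpenBox d (kanRho (Arrow.mk (kanLambda f))) where
  A := u.A
  a := u.a
  mem := u.mem
  y := freeFill u
  face b i hb h := (kanSigma f).toFun (u.face b i hb h)
  fresh b i hb h := (u.fresh b i hb h).map (kanSigma f).map_smul
  adj b i hb h b' i' hb' h' hne := by
    rw [← (kanSigma f).map_sub, ← (kanSigma f).map_sub, u.adj b i hb h b' i' hb' h' hne]
  isOver b i hb h := (rho_kanSigma f _).trans (sub_freeFill_face u hb h).symm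

theorem kanSigma_freeFill {f : Arrow (Sub01 𝔸)} {d : Bool} (u : OpenBox d (kanRho f)) :
    (kanSigma f).toFun (freeFill u) = freeFill (sigmaBox u) := by
  refine (kanLift_freeFill _ (kanSigmaSquare f) u).trans (congrArg freeFill ?_)
  refine OpenBox.ext' rfl rfl (congrArg freeFill ?_) fun _ _ _ _ _ _ => rfl
  exact OpenBox.ext' rfl rfl rfl fun b i hb h _ _ => rho_kanSigma f _

/-- The component `(𝟙, σ_f) : λ_f ⟶ λ_{λ_f}` of the comultiplication. -/
noncomputable def kanComult (f : Arrow (Sub01 𝔸)) :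
    Arrow.mk (kanLambda f) ⟶ Arrow.mk (kanLambda (Arrow.mk (kanLambda f))) :=
  Arrow.homMk (𝟙 f.left) (kanSigma f) rfl

/-- The component `(π_f, 𝟙) : ρ_{ρ_f} ⟶ ρ_f` of the multiplication. -/
noncomputable def kanMult (f : Arrow (Sub01 𝔸)) :
    Arrow.mk (kanRho (Arrow.mk (kanRho f))) ⟶ Arrow.mk (kanRho f) :=
  Arrow.homMk (kanPi f) (𝟙 f.right) (kanPi_rho f)

open FunctorialFactorisation in
theorem kanSigma_naturality {f g : Arrow (Sub01 𝔸)} (φ : f ⟶ g) :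
    kanMap φ ≫ kanSigma g = kanSigma f ≫ kanMap ((L (kanFactorisation 𝔸)).map φ) := by
  refine kanObj_hom_ext (fun x => rfl) fun d u hu => ?_
  -- both sides send the free filler of `u` to the free filler of an image of `u`; the faces of the
  -- two images agree by hypothesis, so that only their `y`-components have to be compared
  refine ((congrArg (kanSigma g).toFun (kanMap_freeFill φ u)).trans (kanSigma_freeFill _)).trans
    (Eq.trans ?_ ((congrArg (kanMap ((L (kanFactorisation 𝔸)).map φ)).toFun
      (kanSigma_freeFill u)).trans (kanMap_freeFill _ _)).symm)
  exact congrArg freeFill (OpenBox.ext' rfl rfl (kanMap_freeFill φ u).symm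
    fun b i hb h _ _ => hu b i hb h)

theorem kanSigma_coassoc (f : Arrow (Sub01 𝔸)) :
    kanSigma f ≫ kanMap (kanComult f) = kanSigma f ≫ kanSigma (Arrow.mk (kanLambda f)) := by
  refine kanObj_hom_ext (fun x => rfl) fun d u hu => ?_
  refine ((congrArg (kanMap (kanComult f)).toFun (kanSigma_freeFill u)).trans
    (kanMap_freeFill _ _)).trans (Eq.trans ?_ ((congrArg (kanSigma _).toFun
      (kanSigma_freeFill u)).trans (kanSigma_freeFill _)).symm)
  exact congrArg freeFill (OpenBox.ext' rfl rfl (kanSigma_freeFill u)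
    fun b i hb h _ _ => hu b i hb h)

open FunctorialFactorisation in
theorem kanSigma_kanMap_counit (f : Arrow (Sub01 𝔸)) :
    kanSigma f ≫ kanMap ((counit (kanFactorisation 𝔸)).app f) = 𝟙 (kanObj f) := by
  refine kanObj_hom_ext (fun x => rfl) fun d u hu => ?_
  refine ((congrArg (kanMap ((counit (kanFactorisation 𝔸)).app f)).toFun
    (kanSigma_freeFill u)).trans (kanMap_freeFill _ _)).trans ?_
  exact congrArg freeFill (OpenBox.ext' rfl rfl (kanRho_freeFill u)
    fun b i hb h _ _ => hu b i hb h)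

open FunctorialFactorisation in
theorem kanPi_naturality {f g : Arrow (Sub01 𝔸)} (φ : f ⟶ g) :
    kanMap ((R (kanFactorisation 𝔸)).map φ) ≫ kanPi g = kanPi f ≫ kanMap φ := by
  refine kanObj_hom_ext (fun x => rfl) fun d u hu => ?_
  refine ((congrArg (kanPi g).toFun (kanMap_freeFill _ u)).trans (kanPi_freeFill _ _)).trans
    (Eq.trans ?_ ((congrArg (kanMap φ).toFun (kanPi_freeFill f u)).trans
      (kanMap_freeFill _ _)).symm)
  exact congrArg freeFill (OpenBox.ext' rfl rfl rfl fun b i hb h _ _ => hu b i hb h)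

theorem kanPi_assoc (f : Arrow (Sub01 𝔸)) :
    kanMap (kanMult f) ≫ kanPi f = kanPi (Arrow.mk (kanRho f)) ≫ kanPi f := by
  refine kanObj_hom_ext (fun x => rfl) fun d u hu => ?_
  refine ((congrArg (kanPi f).toFun (kanMap_freeFill _ u)).trans (kanPi_freeFill _ _)).trans
    (Eq.trans ?_ ((congrArg (kanPi f).toFun (kanPi_freeFill _ u)).trans
      (kanPi_freeFill _ _)).symm)
  exact congrArg freeFill (OpenBox.ext' rfl rfl rfl fun b i hb h _ _ => hu b i hb h)

open FunctorialFactorisation in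
theorem kanMap_unit_kanPi (f : Arrow (Sub01 𝔸)) :
    kanMap ((unit (kanFactorisation 𝔸)).app f) ≫ kanPi f = 𝟙 (kanObj f) := by
  refine kanObj_hom_ext (fun x => rfl) fun d u hu => ?_
  refine ((congrArg (kanPi f).toFun (kanMap_freeFill _ u)).trans (kanPi_freeFill _ _)).trans ?_
  exact congrArg freeFill (OpenBox.ext' rfl rfl rfl fun b i hb h _ _ => hu b i hb h)

variable (𝔸) in
/-- The algebraic weak factorisation system on `(K, λ, ρ)`. -/
noncomputable def kanAWFS : AWFSStructure (kanFactorisation 𝔸) where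
  comult :=
    { app := kanComult
      naturality := fun _ _ φ => Arrow.hom_ext _ _ rfl (kanSigma_naturality φ) }
  mult :=
    { app := kanMult
      naturality := fun _ _ φ => Arrow.hom_ext _ _ (kanPi_naturality φ) rfl }
  comult_coassoc f := Arrow.hom_ext _ _ rfl (kanSigma_coassoc f)
  comult_left_counit f := Arrow.hom_ext _ _ rfl (kanSigma_rho f)
  comult_right_counit f := Arrow.hom_ext _ _ rfl (kanSigma_kanMap_counit f)
  mult_assoc f := Arrow.hom_ext _ _ (kanPi_assoc f) rfl
  mult_left_unit _ := Arrow.hom_ext _ _ rfl rfl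
  mult_right_unit f := Arrow.hom_ext _ _ (kanMap_unit_kanPi f) rfl

end awfs

/-! ### Algebras for the monad `𝖱` -/

section algebra

variable {X Y : Sub01 𝔸} {f : X ⟶ Y}

namespace AlgebraStructure

variable (α : AlgebraStructure (kanAWFS 𝔸).monad (Arrow.mk f))

theorem left_kanLambda (x : X) : α.a.left.toFun ((kanLambda (Arrow.mk f)).toFun x) = x :=
  Sub01.congr_toFun (congrArg (fun k => k.left) α.unit) x

theorem right_eq_id : α.a.right = 𝟙 Y :=
  congrArg (fun k => k.right) α.unit

theorem hom_left (x : kanObj (Arrow.mk f)) :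
    f.toFun (α.a.left.toFun x) = (kanRho (Arrow.mk f)).toFun x :=
  (Sub01.congr_toFun α.a.w x).trans (Sub01.congr_toFun α.right_eq_id _)

/-- The Kan filling operators of an `𝖱`-algebra: apply the algebra map to free fillers. -/
noncomputable def filling (d : Bool) : KanFilling d f where
  fill u := α.a.left.toFun (freeFill (f := Arrow.mk f)
    (u.map (kanLambda (Arrow.mk f)) (𝟙 Y) rfl))
  isFiller u :=
    { face := fun b i hb h => (α.a.left.map_sub _ b i).symm.trans
        ((congrArg _ (sub_freeFill_face (f := Arrow.mk f)
          (u.map (kanLambda (Arrow.mk f)) (𝟙 Y) rfl) hb h)).trans (α.left_kanLambda _))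
      isOver := (α.hom_left _).trans (kanRho_freeFill _) }
  fill_smul π u :=
    (congrArg _ ((congrArg freeFill (OpenBox.map_smul π u)).trans (freeFill_smul π _))).trans
      (α.a.left.map_smul π _)
  fill_subst u c i hc :=
    (congrArg _ ((congrArg freeFill (OpenBox.map_subst u c i hc)).trans
      (freeFill_subst _ c i hc))).trans (α.a.left.map_sub _ c i)

/-- The associativity law, evaluated at the free filler of a box of generators of `K ρ_f`, says
that the algebra map is determined by its filling operators. -/
theorem left_freeFill {d : Bool} (u : OpenBox d (kanRho (Arrow.mk f))) :
    α.a.left.toFun (freeFill u) = (α.filling d).fill (u.map α.a.left α.a.right α.a.w) := by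
  let v : OpenBox d (kanRho (Arrow.mk (kanRho (Arrow.mk f)))) :=
    u.map (kanLambda (Arrow.mk (kanRho (Arrow.mk f)))) (𝟙 Y) rfl
  have h := Sub01.congr_toFun (congrArg (fun k => k.left) α.assoc) (freeFill v)
  exact (congrArg α.a.left.toFun (kanPi_freeFill (Arrow.mk f) v)).symm.trans
    (h.trans (congrArg α.a.left.toFun (kanMap_freeFill α.a v)))

/-- The `𝖱`-algebra structure on `f` determined by Kan filling operators for `f`. -/
noncomputable def ofFilling (F : ∀ d, KanFilling d f) :
    AlgebraStructure (kanAWFS 𝔸).monad (Arrow.mk f) where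
  a := Arrow.homMk (kanLift (g := Arrow.mk f) F (𝟙 (Arrow.mk f))) (𝟙 Y)
    (kanLift_hom (g := Arrow.mk f) F (𝟙 (Arrow.mk f)))
  unit := Arrow.hom_ext _ _ rfl rfl
  assoc := by
    refine Arrow.hom_ext _ _ (kanObj_hom_ext (fun x => rfl) fun d u hu => ?_) rfl
    refine ((congrArg (kanLift (g := Arrow.mk f) F (𝟙 (Arrow.mk f))).toFun
      (kanPi_freeFill _ u)).trans (kanLift_freeFill (g := Arrow.mk f) F _ _)).trans
      (Eq.trans ?_ ((congrArg (kanLift (g := Arrow.mk f) F (𝟙 (Arrow.mk f))).toFun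
        (kanMap_freeFill _ u)).trans (kanLift_freeFill (g := Arrow.mk f) F _ _)).symm)
    exact congrArg (F d).fill (OpenBox.ext' rfl rfl rfl fun b i hb h _ _ => hu b i hb h)

end AlgebraStructure

variable (f) in
/-- `𝖱`-algebra structures on `f` correspond to Kan filling operators for both kinds of boxes. -/
noncomputable def algebraStructureEquiv :
    AlgebraStructure (kanAWFS 𝔸).monad (Arrow.mk f) ≃ ∀ d, KanFilling d f where
  toFun α := α.filling
  invFun := AlgebraStructure.ofFilling
  left_inv α := by
    refine AlgebraStructure.ext (Arrow.hom_ext _ _ ?_ α.right_eq_id.symm)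
    refine kanObj_hom_ext (fun x => (α.left_kanLambda x).symm) fun d u hu => ?_
    refine (kanLift_freeFill (g := Arrow.mk f) α.filling (𝟙 _) u).trans
      (Eq.trans ?_ (α.left_freeFill u).symm)
    exact congrArg (α.filling d).fill (OpenBox.ext' rfl rfl
      (Sub01.congr_toFun α.right_eq_id _).symm fun b i hb h _ _ => hu b i hb h)
  right_inv F := funext fun d => KanFilling.ext <| funext fun u =>
    kanLift_freeFill (g := Arrow.mk f) F (𝟙 _)
      (u.map (p' := kanRho (Arrow.mk f)) (kanLambda (Arrow.mk f)) (𝟙 Y) rfl)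

/-- A dependent function on `Bool` is the pair of its values at `true` and `false`. -/
def piBoolEquivProd (P : Bool → Type u) : (∀ d, P d) ≃ P true × P false where
  toFun F := (F true, F false)
  invFun p d := match d with
    | true => p.1
    | false => p.2
  left_inv F := funext fun d => by cases d <;> rfl
  right_inv _ := rfl

end algebra

end kan

end KanAWFS

theorem mainTheorem1 (𝔸 : Type u) [Infinite 𝔸] :
    -- `K f` is the colimit in `01Sub` of the countable sequence of stages
    (∀ f : Arrow (Sub01 𝔸),
      Nonempty (Limits.IsColimit (seqCocone (stageFunctor f)))) ∧
    ∃ W : AWFSStructure (kanFactorisation 𝔸),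
      -- the comultiplication sends `(u, y)` to `(σ ∘ u, (u, y))`
      (∀ (f : Arrow (Sub01 𝔸)) (d : Bool) (u : OpenBox d (kanRho f)),
        ∃ v : OpenBox d (kanRho (Arrow.mk (kanLambda f))),
          v.A = u.A ∧ v.a = u.a ∧ v.y = freeFill u ∧
          (∀ b i hb h hb' h',
            v.face b i hb' h' = (W.comonad.δ.app f).right.toFun (u.face b i hb h)) ∧
          (W.comonad.δ.app f).right.toFun (freeFill u) = freeFill v) ∧
      -- the multiplication sends `(u, y)` to `(π ∘ u, y)`
      (∀ (f : Arrow (Sub01 𝔸)) (d : Bool)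
        (u : OpenBox d (kanRho (Arrow.mk (kanRho f)))),
        (W.monad.μ.app f).left.toFun (freeFill u) =
          freeFill (f := f) (u.map (W.monad.μ.app f).left (W.monad.μ.app f).right
            (W.monad.μ.app f).w)) ∧
      -- `𝖱`-algebra structures correspond to pairs of uniform Kan filling operators
      (∀ {X Y : Sub01 𝔸} (f : X ⟶ Y),
        ∃ Φ : AlgebraStructure W.monad (Arrow.mk f) ≃
            KanFilling true f × KanFilling false f,
          ∀ α : AlgebraStructure W.monad (Arrow.mk f),
            -- the filling operators are obtained by applying the algebra map to free fillers
            (∀ u : OpenBox true f, (Φ α).1.fill u =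
              α.a.left.toFun (freeFill (f := Arrow.mk f)
                (u.map (kanLambda (Arrow.mk f)) (𝟙 Y) rfl))) ∧
            (∀ u : OpenBox false f, (Φ α).2.fill u =
              α.a.left.toFun (freeFill (f := Arrow.mk f)
                (u.map (kanLambda (Arrow.mk f)) (𝟙 Y) rfl))) ∧
            -- and the algebra map is recovered by sending free fillers to chosen fillers
            (∀ u : OpenBox true (kanRho (Arrow.mk f)),
              α.a.left.toFun (freeFill u) =
                (Φ α).1.fill (u.map α.a.left α.a.right α.a.w)) ∧
            (∀ u : OpenBox false (kanRho (Arrow.mk f)),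
              α.a.left.toFun (freeFill u) =
                (Φ α).2.fill (u.map α.a.left α.a.right α.a.w))) :=
  ⟨fun f => nonempty_isColimit_seqCocone (stageFunctor f), kanAWFS 𝔸,
    fun _ _ u => ⟨sigmaBox u, rfl, rfl, rfl, fun _ _ _ _ _ _ => rfl, kanSigma_freeFill u⟩,
    fun f _ u => kanPi_freeFill f u,
    fun {_ _} f => ⟨(algebraStructureEquiv f).trans (piBoolEquivProd fun d => KanFilling d f),
      fun α => ⟨fun _ => rfl, fun _ => rfl, α.left_freeFill, α.left_freeFill⟩⟩⟩
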